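/- Let $\Delta=\{|t|<1\}$, $\Delta^*=\Delta\setminus\{0\}$, and let $\mathbb{H}_g$ be the Siegel upper half-space. For $\tau\in\mathbb{H}_g$, $z\in\mathbb{C}^g$ put $$\|\theta\|(\tau,z)=\det(\mathrm{Im}\,\tau)^{1/4}\exp\bigl(-\pi\,{}^t(\mathrm{Im}\,z)(\mathrm{Im}\,\tau)^{-1}(\mathrm{Im}\,z)\bigr)\Bigl|\sum_{n\in\mathbb{Z}^g}\exp(\pi i\,{}^tn\tau n+2\pi i\,{}^tnz)\Bigr| .$$ Let $f\colon\mathscr{A}\to\Delta^*$ be a holomorphic family of principally polarized complex abelian varieties of dimension $g\ge 1$, and let $T_f\colon\Delta^*\to\mathbb{H}_g$ be a multi-valued holomorphic period map of $f$, so that $\mathscr{A}_t\cong\mathbb{C}^g/(\mathbb{Z}^g+T_f(t)\mathbb{Z}^g)$ as principally polarized abelian varieties, holomorphically in $t$. Suppose that $T_f$ is in the normal form $$T_f(t^m)=\begin{pmatrix}S_1(t)&S_3(t)\\ {}^tS_3(t)&\frac{m\log t}{2\pi i}B+S_2(t)\end{pmatrix}$$ with an integer $m\ge1$, integers $g_1,g_2\ge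 0$ with $g_1+g_2=g$, holomorphic maps $S_1\colon\Delta\to\mathbb{H}_{g_1}$, $S_3\colon\Delta\to\mathbb{C}^{g_1\times g_2}$, $S_2\colon\Delta\to\mathbb{C}^{g_2\times g_2}$, and a symmetric positive definite $B\in\mathbb{Q}^{g_2\times g_2}$. Let $\Sigma_f=\mathbb{R}^{g_2}/B\mathbb{Z}^{g_2}$, so $\dim\Sigma_f=g_2$, and for $\nu\in\mathbb{R}^{g_2}$ let $$\|\Psi\|(\nu)=\min_{\lambda\in B\mathbb{Z}^{g_2}}\tfrac12\,{}^t(\nu+\lambda)B^{-1}(\nu+\lambda),$$ a function on $\Sigma_f$. For a multi-valued map $\widetilde z=(\widetilde z_1,\widetilde z_2)\colon\Delta^*\to\mathbb{C}^{g_1}\times\mathbb{C}^{g_2}$ let $\mathrm{trop}(\widetilde z)\in\Sigma_f$ be the class of $-\lim_{t\to0}2\pi\,\mathrm{Im}(\widetilde z_2(t))/\log|t|$, if this limit exists, and for a section $z$ of $f$ let $\mathrm{trop}(z)=\mathrm{trop}(\widetilde z)$ for a multi-valued holomorphic lift $\widetilde z$ of $z$. Limits of multi-valued functions as $t\to0$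 are taken over all branches simultaneously. (1) There is a real-analytic function $\alpha\colon\mathbb{R}^{2g}\to\mathbb{R}_{\ge0}$, not identically zero, such that for all $a,b\in\mathbb{R}^g$ and every section $z\colon\Delta^*\to\mathscr{A}$ of $f$ with multi-valued lift $\widetilde z(t)=a+T_f(t)b$, the class $\mathrm{trop}(z)$ exists and $$\lim_{t\to0}\Bigl(\|\theta\|(T_f(t),\widetilde z(t))\cdot|t|^{-\|\Psi\|(\mathrm{trop}(z))}(-\log|t|)^{-\dim\Sigma_f/4}\Bigr)^2=\alpha(a,b).$$ (2) For arbitrary real vectors, whether or not $a+T_f(t)b$ descends to a single-valued section: for every $c\in\mathbb{R}^{g_2}$ there is a real-analytic function $\alpha_c\colon\mathbb{R}^{2g}\to\mathbb{R}_{\ge0}$, not identically zero on the set of $(a,b)$ with $b_2=c$ (where $b_2$ denotes the last $g_2$ coordinates of $b$), such that for all $a,b\in\mathbb{R}^g$ with $b_2=c$ the class $\mathrm{trop}(\widetilde z)$ of $\widetilde z(t)=a+T_f(t)b$ exists, and the limit in (1), with $\mathrm{trop}(\widetilde z)$ in place of $\mathrm{trop}(z)$, exists and equals $\alpha_c(a,b)$.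 -/

import Mathlib

open Filter Topology Matrix
open scoped ComplexOrder

noncomputable section

/-! ### Siegel upper half-space and the Riemann theta function -/

/-- The Siegel upper half-space: symmetric complex matrices with positive definite
imaginary part. -/
def SiegelSpace (ι : Type) [Fintype ι] : Set (Matrix ι ι ℂ) :=
  {τ | τ.IsSymm ∧ (τ.map Complex.im).PosDef}

/-- The Riemann theta function
`θ(τ, z) = ∑_{n ∈ ℤ^ι} exp(π i ᵗn τ n + 2 π i ᵗn z)`. -/
def riemannTheta {ι : Type} [Fintype ι] (τ : Matrix ι ι ℂ) (z : ι → ℂ) : ℂ :=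
  ∑' n : ι → ℤ,
    Complex.exp (Real.pi * Complex.I * ((fun i => (n i : ℂ)) ⬝ᵥ τ *ᵥ (fun i => (n i : ℂ)))
      + 2 * Real.pi * Complex.I * ((fun i => (n i : ℂ)) ⬝ᵥ z))

/-- The normed theta function
`‖θ‖(τ, z) = det(Im τ)^{1/4} exp(-π ᵗ(Im z) (Im τ)⁻¹ (Im z)) |θ(τ, z)|`. -/
def normTheta {ι : Type} [Fintype ι] [DecidableEq ι] (τ : Matrix ι ι ℂ) (z : ι → ℂ) : ℝ :=
  (τ.map Complex.im).det ^ (1 / 4 : ℝ)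
    * Real.exp (-(Real.pi * ((fun i => (z i).im) ⬝ᵥ (τ.map Complex.im)⁻¹ *ᵥ fun i => (z i).im)))
    * ‖riemannTheta τ z‖

/-! ### Polarized real tori -/

/-- The lattice `B ℤ^κ` in `ℝ^κ`. -/
def realLattice {κ : Type} [Fintype κ] (B : Matrix κ κ ℝ) : AddSubgroup (κ → ℝ) :=
  ((Matrix.mulVecLin B).toAddMonoidHom.comp ((Int.castAddHom ℝ).compLeft κ)).range

/-- The real torus `Σ_B = ℝ^κ / B ℤ^κ`. -/
abbrev RealTorus {κ : Type} [Fintype κ] (B : Matrix κ κ ℝ) : Type :=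
  (κ → ℝ) ⧸ realLattice B

/-- The modified tropical theta function on `Σ_B`, where the inner product on `ℝ^κ` is
`[x, y]_B = ᵗx B⁻¹ y`. Its value at the class of `ν` is the minimum of `½ [ν + l, ν + l]_B` over
`l` in the lattice, that is, the minimum of `½ [y, y]_B` over all representatives `y`. -/
def normPsi {κ : Type} [Fintype κ] [DecidableEq κ] (B : Matrix κ κ ℝ) (x : RealTorus B) : ℝ :=
  ⨅ y : {y : κ → ℝ // (QuotientAddGroup.mk y : RealTorus B) = x},
    (1 / 2 : ℝ) * ((y : κ → ℝ) ⬝ᵥ B⁻¹ *ᵥ (y : κ → ℝ))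

/-! ### The punctured disc and its universal covering -/

/-- The punctured unit disc `Δ*`. -/
def PuncturedDisc : Type := {t : ℂ // t ≠ 0 ∧ ‖t‖ < 1}

/-- The universal covering map `w ↦ exp(2 π i w)` of `Δ*` by the upper half-plane. Multi-valued
functions on `Δ*` are functions of `w`, the choice of a value of `log t` being `2 π i w`. -/
def nome (w : ℂ) : ℂ := Complex.exp (2 * Real.pi * Complex.I * w)

theorem nome_mem (w : ℂ) (hw : 0 < w.im) : nome w ≠ 0 ∧ ‖nome w‖ < 1 := by
  refine ⟨Complex.exp_ne_zero _, ?_⟩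
  rw [nome, Complex.norm_exp, Real.exp_lt_one_iff]
  have h : (2 * (Real.pi : ℂ) * Complex.I * w).re = -(2 * Real.pi * w.im) := by
    simp [Complex.mul_re]
  rw [h]
  have := Real.pi_pos
  have : 0 < 2 * Real.pi * w.im := by positivity
  linarith

/-- The point of `Δ*` under a point of the upper half-plane. -/
def nomePt (w : ℂ) (hw : 0 < w.im) : PuncturedDisc := ⟨nome w, nome_mem w hw⟩

/-- The filter `t → 0`, `t ≠ 0`, for multi-valued functions of `t` (all branches at once). -/
def toPuncture : Filter ℂ := comap nome (𝓝[≠] (0 : ℂ))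

/-! ### Families of principally polarized abelian varieties over the punctured disc -/

/-- The value `ᵗx H ȳ` of the Hermitian form with matrix `H`. -/
def hermForm {ι : Type} [Fintype ι] (H : Matrix ι ι ℂ) (x y : ι → ℂ) : ℂ :=
  x ⬝ᵥ H *ᵥ star y

/-- `(l, μ)` is a basis of the lattice `L`, symplectic for the alternating form
`E = Im H`. -/
structure IsSymplecticBasis {ι : Type} [Fintype ι] [DecidableEq ι]
    (L : AddSubgroup (ι → ℂ)) (H : Matrix ι ι ℂ) (l μ : ι → ι → ℂ) : Prop where
  linearIndependent : LinearIndependent ℝ (Sum.elim l μ)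
  closure_eq : AddSubgroup.closure (Set.range (Sum.elim l μ)) = L
  form_left : ∀ i j, (hermForm H (l i) (l j)).im = 0
  form_right : ∀ i j, (hermForm H (μ i) (μ j)).im = 0
  form_mixed : ∀ i j, (hermForm H (μ i) (l j)).im = if i = j then 1 else 0

/-- A holomorphic family of principally polarized complex abelian varieties of dimension `#ι` over
`Δ*`. The bundle of Lie algebras of the fibres is a holomorphic vector bundle on the Stein curve
`Δ*`, hence trivial, so the fibre over `t` is `ℂ^ι / L_t` for a full lattice `L_t`. The principal
polarization of the fibre is a positive definite Hermitian form `H_t` whose imaginary part is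
integral and unimodular on `L_t`. Locally on `Δ*` there is a holomorphically varying symplectic
basis of `L_t`. -/
structure PPAVFamily (ι : Type) [Fintype ι] [DecidableEq ι] where
  lattice : PuncturedDisc → AddSubgroup (ι → ℂ)
  herm : PuncturedDisc → Matrix ι ι ℂ
  herm_posDef : ∀ t, (herm t).PosDef
  exists_local_basis : ∀ t₀ : PuncturedDisc, ∃ U : Set ℂ, IsOpen U ∧ t₀.1 ∈ U ∧
    ∃ l μ : ι → ℂ → ι → ℂ,
      (∀ j, DifferentiableOn ℂ (l j) U) ∧ (∀ j, DifferentiableOn ℂ (μ j) U) ∧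
      ∀ t : PuncturedDisc, t.1 ∈ U →
        IsSymplecticBasis (lattice t) (herm t) (fun j => l j t.1) (fun j => μ j t.1)

namespace PPAVFamily

variable {ι : Type} [Fintype ι] [DecidableEq ι]

/-- The fibre `𝒜_t = ℂ^ι / L_t`. -/
abbrev fiber (F : PPAVFamily ι) (t : PuncturedDisc) : Type := (ι → ℂ) ⧸ F.lattice t

/-- A multi-valued holomorphic period map of the family: a holomorphic map `T` from the universal
covering of `Δ*` to the Siegel upper half-space together with holomorphically varying linear
coordinates `frame w : ℂ^ι ≃ ℂ^ι` which carry the columns of `(1, T w)` to a symplectic basis of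
the lattice `L_t`, `t = exp(2 π i w)`. So `frame w` induces an isomorphism of principally polarized
abelian varieties from `ℂ^ι / (ℤ^ι + T(w) ℤ^ι)` to the fibre over `t`. -/
structure PeriodMap (F : PPAVFamily ι) where
  T : ℂ → Matrix ι ι ℂ
  frame : ℂ → Matrix ι ι ℂ
  mem_siegel : ∀ w : ℂ, 0 < w.im → T w ∈ SiegelSpace ι
  holomorphic_T : ∀ i j, DifferentiableOn ℂ (fun w => T w i j) {w | 0 < w.im}
  holomorphic_frame : ∀ i j, DifferentiableOn ℂ (fun w => frame w i j) {w | 0 < w.im}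
  isUnit_frame : ∀ w : ℂ, 0 < w.im → IsUnit (frame w)
  isSymplecticBasis : ∀ (w : ℂ) (hw : 0 < w.im),
    IsSymplecticBasis (F.lattice (nomePt w hw)) (F.herm (nomePt w hw))
      (fun j => frame w *ᵥ Pi.single j 1) (fun j => frame w *ᵥ (T w *ᵥ Pi.single j 1))

/-- `zt` is a multi-valued lift of the section `z`, in the coordinates in which the fibre is
`ℂ^ι / (ℤ^ι + T(w) ℤ^ι)`. -/
def PeriodMap.IsLift {F : PPAVFamily ι} (P : F.PeriodMap) (z : (t : PuncturedDisc) → F.fiber t)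
    (zt : ℂ → ι → ℂ) : Prop :=
  ∀ (w : ℂ) (hw : 0 < w.im), z (nomePt w hw) = QuotientAddGroup.mk (P.frame w *ᵥ zt w)

/-- The multi-valued map `t ↦ a + T(t) b` for real vectors `a`, `b`. -/
def PeriodMap.flatMap {F : PPAVFamily ι} (P : F.PeriodMap) (a b : ι → ℝ) (w : ℂ) : ι → ℂ :=
  (fun i => (a i : ℂ)) + P.T w *ᵥ (fun i => (b i : ℂ))

end PPAVFamily

/-- A degeneration normal form of a multi-valued map `T` on `Δ*`: for some `m ≥ 1`, and with
`log s = 2 π i w` for `s = nome w` (so that `m w` lies over `s ^ m`, and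
`(m log s / (2 π i)) B = (m w) B`),
`T(s ^ m) = [[S₁(s), S₃(s)], [ᵗS₃(s), (m log s / (2 π i)) B + S₂(s)]]`,
where `S₁`, `S₂`, `S₃` are holomorphic on the whole unit disc, `S₁` has values in the Siegel upper
half-space and `B` is a rational symmetric positive definite matrix. -/
structure NormalForm {g₁ g₂ : ℕ} (T : ℂ → Matrix (Fin g₁ ⊕ Fin g₂) (Fin g₁ ⊕ Fin g₂) ℂ) where
  m : ℕ
  m_pos : 0 < m
  S₁ : ℂ → Matrix (Fin g₁) (Fin g₁) ℂ
  S₂ : ℂ → Matrix (Fin g₂) (Fin g₂) ℂ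
  S₃ : ℂ → Matrix (Fin g₁) (Fin g₂) ℂ
  ratB : Matrix (Fin g₂) (Fin g₂) ℚ
  holomorphic_S₁ : ∀ i j, DifferentiableOn ℂ (fun s => S₁ s i j) (Metric.ball 0 1)
  holomorphic_S₂ : ∀ i j, DifferentiableOn ℂ (fun s => S₂ s i j) (Metric.ball 0 1)
  holomorphic_S₃ : ∀ i j, DifferentiableOn ℂ (fun s => S₃ s i j) (Metric.ball 0 1)
  mem_siegel : ∀ s ∈ Metric.ball (0 : ℂ) 1, S₁ s ∈ SiegelSpace (Fin g₁)
  posDef : (ratB.map (fun q : ℚ => (q : ℝ))).PosDef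
  eq_fromBlocks : ∀ w : ℂ, 0 < w.im →
    T (m * w) = Matrix.fromBlocks (S₁ (nome w)) (S₃ (nome w)) (S₃ (nome w))ᵀ
      ((m * w) • ratB.map (fun q : ℚ => (q : ℂ)) + S₂ (nome w))

namespace NormalForm

variable {g₁ g₂ : ℕ} {T : ℂ → Matrix (Fin g₁ ⊕ Fin g₂) (Fin g₁ ⊕ Fin g₂) ℂ}

/-- The matrix `B` as a real matrix; the real torus of the family is `Σ_B`, of dimension `g₂`. -/
def B (D : NormalForm T) : Matrix (Fin g₂) (Fin g₂) ℝ := D.ratB.map (fun q : ℚ => (q : ℝ))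

/-- `x` is the class modulo `B ℤ^{g₂}` of `- lim_{t → 0} 2 π Im(z̃₂(t)) / log |t|`, where
`z̃₂` is the vector of the last `g₂` coordinates of the multi-valued map `zt`. -/
def HasTrop (D : NormalForm T) (zt : ℂ → Fin g₁ ⊕ Fin g₂ → ℂ) (x : RealTorus D.B) : Prop :=
  ∃ v : Fin g₂ → ℝ,
    Tendsto (fun w : ℂ => fun j : Fin g₂ =>
      -(2 * Real.pi * (zt w (Sum.inr j)).im / Real.log ‖nome w‖)) toPuncture (𝓝 v) ∧
    QuotientAddGroup.mk v = x

/-- `x = trop(z)` for a section `z`: the class above, for a multi-valued holomorphic lift of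
`z`. -/
def IsTrop {F : PPAVFamily (Fin g₁ ⊕ Fin g₂)} {P : F.PeriodMap} (D : NormalForm P.T)
    (z : (t : PuncturedDisc) → F.fiber t) (x : RealTorus D.B) : Prop :=
  ∃ zt : ℂ → Fin g₁ ⊕ Fin g₂ → ℂ,
    (∀ i, DifferentiableOn ℂ (fun w => zt w i) {w | 0 < w.im}) ∧ P.IsLift z zt ∧ D.HasTrop zt x

/-- The quantity `(‖θ‖(T(t), z̃(t)) |t|^{-‖Ψ‖(x)} (-log |t|)^{-g₂/4})²`, `t = nome w`. -/
def scaledTheta (D : NormalForm T) (zt : ℂ → Fin g₁ ⊕ Fin g₂ → ℂ) (x : RealTorus D.B)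
    (w : ℂ) : ℝ :=
  (normTheta (T w) (zt w) * ‖nome w‖ ^ (-normPsi D.B x)
    * (-Real.log ‖nome w‖) ^ (-((g₂ : ℝ) / 4))) ^ 2

end NormalForm

end

noncomputable section

/-! Put `t = nome w`, so that `-log |t| = 2π Im w`, and let `Q` be the quadratic form of `B`. At `a
+ T b` the Gaussian factor of the normed theta function completes the square: what remains is
`det(Im T)^{1/4}` times the absolute value of the theta series with real characteristic `b`
(`normTheta_add_mulVec`). In normal form its term at `n` carries the factor `exp(π i w Q(n₂ + b₂))`,
and the least value of `Q(n₂ + b₂)` is `2‖Ψ‖` at the class of `B b₂`, which is the tropicalization.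
Multiplying by `|t|^{-‖Ψ‖}` therefore removes the largest exponential. The terms with `n₂ + b₂` not
shortest die, and dominated convergence gives a limit series over the remaining `n`
(`tendsto_tsum_charTerm`). The determinant grows like `(Im w)^{g₂} det(Im S₁(0)) det B`
(`tendsto_det_div_pow`), which accounts for the power of the logarithm.

For fixed `b₂ = c` the set of contributing `n` is fixed. The limit is then an exponential of a
polynomial times a rapidly convergent series of exponentials of linear forms in `(a, b₁)`, hence
analytic (`analyticAt_limitTheta`). As a Fourier series in `a` it has a nonzero coefficient, so it
does not vanish identically (`exists_limitTheta_ne_zero`). This gives (2).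

For (1) one function must serve all sections, although the limit need not vary analytically with
`b₂`. Going around the puncture changes `T` by a real matrix, so the frames over one point send the
standard basis to lattice vectors of constant length. There are finitely many of these, so two
frames agree (`NormalForm.exists_frame_eq`). Comparing the values of a section in these two frames
forces `N b₂` to be integral, with `N` independent of the section (`NormalForm.exists_denominator`).
The squared limit depends on `c` only modulo integers, so finitely many limit functions occur, and
Fejér kernels in `b₂` glue them into one nonnegative analytic function
(`NormalForm.interpolatedLimit_eq`). -/

/-! ### Coercive quadratic forms and Gaussian sums -/

theorem exists_pos_mul_sq_norm_le {E : Type*} [NormedAddCommGroup E] [NormedSpace ℝ E]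
    [FiniteDimensional ℝ E] (f : E → ℝ) (hf : Continuous f)
    (hs : ∀ (r : ℝ) x, f (r • x) = r ^ 2 * f x) (hp : ∀ x, x ≠ 0 → 0 < f x) :
    ∃ c > 0, ∀ x, c * ‖x‖ ^ 2 ≤ f x := by
  have h0 : f 0 = 0 := by simpa using hs 0 0
  have : ProperSpace E := FiniteDimensional.proper ℝ E
  rcases subsingleton_or_nontrivial E with h | h
  · exact ⟨1, one_pos, fun x => by rw [Subsingleton.elim x 0, h0]; simp⟩
  obtain ⟨x₀, hx₀, hmin⟩ := (isCompact_sphere (0 : E) 1).exists_isMinOn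
    (NormedSpace.sphere_nonempty.mpr zero_le_one) hf.continuousOn
  have hx₀' : ‖x₀‖ = 1 := by simpa using hx₀
  refine ⟨f x₀, hp x₀ (by rintro rfl; simp at hx₀'), fun x => ?_⟩
  by_cases hx : x = 0
  · subst hx; simp [h0]
  have hn : ‖x‖ ≠ 0 := norm_ne_zero_iff.mpr hx
  have h1 : f x₀ ≤ f (‖x‖⁻¹ • x) := hmin (by simp [norm_smul, hn])
  have h2 : f x = ‖x‖ ^ 2 * f (‖x‖⁻¹ • x) := by
    rw [hs]; field_simp
  rw [h2, mul_comm]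
  gcongr

theorem dotProduct_self_le_card_mul_sq_norm {ι : Type*} [Fintype ι] (x : ι → ℝ) :
    x ⬝ᵥ x ≤ Fintype.card ι * ‖x‖ ^ 2 := by
  calc x ⬝ᵥ x ≤ ∑ _i : ι, ‖x‖ ^ 2 := by
        refine Finset.sum_le_sum fun i _ => ?_
        have := norm_le_pi_norm x i
        rw [← sq, ← sq_abs]
        exact pow_le_pow_left₀ (abs_nonneg _) this 2
    _ = _ := by simp

theorem Matrix.PosDef.exists_pos_mul_sq_norm_le {ι : Type*} [Fintype ι] {M : Matrix ι ι ℝ}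
    (hM : M.PosDef) : ∃ c > 0, ∀ x : ι → ℝ, c * ‖x‖ ^ 2 ≤ x ⬝ᵥ M *ᵥ x :=
  _root_.exists_pos_mul_sq_norm_le (fun x : ι → ℝ => x ⬝ᵥ M *ᵥ x)
    (by fun_prop) (fun r x => by simp [mulVec_smul]; ring)
    (fun x hx => by simpa using hM.dotProduct_mulVec_pos hx)

theorem summable_prod_apply {ι α : Type*} [Fintype ι] [DecidableEq ι] {g : ι → α → ℝ}
    (h0 : ∀ i a, 0 ≤ g i a) (hg : ∀ i, Summable (g i)) :
    Summable fun n : ι → α => ∏ i, g i (n i) := by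
  classical
  refine summable_of_sum_le (c := ∏ i, ∑' a, g i a)
    (fun n => Finset.prod_nonneg fun i _ => h0 i _) fun s => ?_
  calc ∑ n ∈ s, ∏ i, g i (n i)
      ≤ ∑ n ∈ Fintype.piFinset fun i => s.image fun n => n i, ∏ i, g i (n i) := by
        refine Finset.sum_le_sum_of_subset_of_nonneg (fun n hn => ?_)
          fun n _ _ => Finset.prod_nonneg fun i _ => h0 i _
        exact Fintype.mem_piFinset.mpr fun i => Finset.mem_image_of_mem _ hn
    _ = ∏ i, ∑ a ∈ s.image fun n => n i, g i a := (Finset.prod_univ_sum _ _).symm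
    _ ≤ _ := Finset.prod_le_prod (fun i _ => Finset.sum_nonneg fun a _ => h0 i a)
        fun i _ => (hg i).sum_le_tsum _ fun a _ => h0 i a

theorem summable_exp_neg_mul_sq_add_mul_abs {δ : ℝ} (hδ : 0 < δ) (R : ℝ) :
    Summable fun n : ℤ => Real.exp (-(δ * (n : ℝ) ^ 2) + R * |(n : ℝ)|) := by
  have h1 : Summable fun n : ℤ => Real.exp (-|(n : ℝ)|) := by
    refine Summable.of_nat_of_neg ?_ ?_
    · simpa using Real.summable_exp_neg_nat
    · simpa using Real.summable_exp_neg_nat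
  refine Summable.of_nonneg_of_le (fun n => (Real.exp_pos _).le) (fun n => ?_)
    (h1.mul_left (Real.exp ((R + 1) ^ 2 / (4 * δ))))
  rw [← Real.exp_add]
  refine Real.exp_le_exp.mpr ?_
  -- Completing the square: `(R + 1) x - δ x²` is at most `(R + 1)² / (4δ)`, so the Gaussian is
  -- dominated by a multiple of `exp(-|n|)`.
  have h2 : (R + 1) ^ 2 / (4 * δ) - (R + 1) * |(n : ℝ)| + δ * |(n : ℝ)| ^ 2
      = δ * (|(n : ℝ)| - (R + 1) / (2 * δ)) ^ 2 := by field_simp; ring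
  have h3 := mul_nonneg hδ.le (sq_nonneg (|(n : ℝ)| - (R + 1) / (2 * δ)))
  rw [← h2, sq_abs] at h3
  linarith

theorem summable_exp_neg_quadratic {ι : Type*} [Fintype ι] {δ : ℝ} (hδ : 0 < δ) (R : ℝ) :
    Summable fun n : ι → ℤ =>
      Real.exp (-(δ * ∑ i, (n i : ℝ) ^ 2) + R * ∑ i, |(n i : ℝ)|) := by
  classical
  refine (summable_prod_apply (ι := ι) (fun _ n => (Real.exp_pos _).le)
    fun _ => summable_exp_neg_mul_sq_add_mul_abs hδ R).congr fun n => ?_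
  rw [← Real.exp_sum, Finset.sum_add_distrib, Finset.sum_neg_distrib, Finset.mul_sum,
    Finset.mul_sum]

/-! ### Analyticity and nonvanishing of series of exponentials -/

/-- Each exponential is expanded at `x₀` and the double sum is rearranged. Since `‖ℓ n‖ ^ k / k!` is
at most `exp ‖ℓ n‖`, all Taylor coefficients have a common bound, which gives radius of convergence
at least 1. -/
theorem analyticAt_tsum_mul_cexp {E I : Type*} [NormedAddCommGroup E] [NormedSpace ℝ E]
    (c : I → ℂ) (ℓ : I → E →L[ℝ] ℂ)
    (h : ∀ R : ℝ, Summable fun n => ‖c n‖ * Real.exp (R * ‖ℓ n‖)) (x₀ : E) :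
    AnalyticAt ℝ (fun x => ∑' n, c n * Complex.exp (ℓ n x)) x₀ := by
  let a : I → ℂ := fun n => c n * Complex.exp (ℓ n x₀)
  have ha : ∀ R : ℝ, Summable fun n => ‖a n‖ * Real.exp (R * ‖ℓ n‖) := by
    intro R
    refine Summable.of_nonneg_of_le (fun n => by positivity) (fun n => ?_) (h (‖x₀‖ + R))
    simp only [a]
    rw [norm_mul, mul_assoc, add_mul, Real.exp_add]
    gcongr
    rw [Complex.norm_exp]
    refine Real.exp_le_exp.mpr ((Complex.re_le_norm _).trans ?_)
    rw [mul_comm]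
    exact (ℓ n).le_opNorm x₀
  let φ : (n : I) → (k : ℕ) → ContinuousMultilinearMap ℝ (fun _ : Fin k => E) ℂ := fun n k =>
    (a n / k.factorial) •
      (ContinuousMultilinearMap.mkPiAlgebraFin ℝ k ℂ).compContinuousLinearMap fun _ => ℓ n
  have hφ : ∀ n k, ‖φ n k‖ ≤ ‖a n‖ * (‖ℓ n‖ ^ k / k.factorial) := by
    intro n k
    simp only [φ]
    rw [norm_smul, norm_div, Complex.norm_natCast, div_mul_eq_mul_div, mul_div_assoc]
    gcongr
    refine (ContinuousMultilinearMap.norm_compContinuousLinearMap_le _ _).trans ?_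
    simp
  have hexp : ∀ n k, ‖ℓ n‖ ^ k / k.factorial ≤ Real.exp (1 * ‖ℓ n‖) := by
    intro n k
    rw [one_mul]
    exact Real.pow_div_factorial_le_exp _ (norm_nonneg _) k
  have hsum : ∀ k, Summable fun n => ‖φ n k‖ := fun k =>
    Summable.of_nonneg_of_le (fun _ => norm_nonneg _)
      (fun n => (hφ n k).trans (by gcongr; exact hexp n k)) (ha 1)
  let p : FormalMultilinearSeries ℝ E ℂ := fun k => ∑' n, φ n k
  refine ⟨p, 1, ?_, by norm_num, ?_⟩
  · refine p.le_radius_of_bound (r := 1) (∑' n, ‖a n‖ * Real.exp (1 * ‖ℓ n‖)) fun k => ?_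
    simp only [NNReal.coe_one, one_pow, mul_one, p]
    exact tsum_of_norm_bounded (ha 1).hasSum fun n => (hφ n k).trans (by gcongr; exact hexp n k)
  · intro y hy
    let f : ℕ × I → ℂ := fun q => a q.2 * ((ℓ q.2 y) ^ q.1 / q.1.factorial)
    have hf : Summable f := by
      rw [← (Equiv.prodComm I ℕ).summable_iff]
      refine Summable.of_norm ?_
      have hn : ∀ n k, ‖f (k, n)‖ = ‖a n‖ * (‖ℓ n y‖ ^ k / k.factorial) := by
        intro n k; simp [f]
      have hk : ∀ n, HasSum (fun k => ‖f (k, n)‖) (‖a n‖ * Real.exp ‖ℓ n y‖) := by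
        intro n
        simp_rw [hn, Real.exp_eq_exp_ℝ]
        exact (NormedSpace.expSeries_div_hasSum_exp ‖ℓ n y‖).mul_left _
      refine (summable_prod_of_nonneg (fun _ => norm_nonneg _)).mpr ⟨fun n => (hk n).summable, ?_⟩
      refine Summable.of_nonneg_of_le (fun n => tsum_nonneg fun _ => norm_nonneg _)
        (fun n => ?_) (ha ‖y‖)
      simp only [Function.comp_apply, Equiv.prodComm_apply, Prod.swap_prod_mk]
      rw [(hk n).tsum_eq, mul_comm ‖y‖]
      gcongr
      exact (ℓ n).le_opNorm y
    have hin : ∀ k, HasSum (fun n => f (k, n)) (p k fun _ => y) := by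
      intro k
      have h1 := (hsum k).of_norm.hasSum
      have h2 := h1.mapL (ContinuousMultilinearMap.apply ℝ (fun _ : Fin k => E) ℂ fun _ => y)
      refine (h2.congr_fun ?_)
      intro n
      simp [φ, f, ContinuousMultilinearMap.apply]
      ring
    have hval : ∑' q, f q = ∑' n, c n * Complex.exp (ℓ n (x₀ + y)) := by
      have hf' : Summable fun q => f (Equiv.prodComm I ℕ q) :=
        (Equiv.prodComm I ℕ).summable_iff.mpr hf
      rw [← (Equiv.prodComm I ℕ).tsum_eq, hf'.tsum_prod]
      refine tsum_congr fun n => ?_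
      simp only [Equiv.prodComm_apply, Prod.swap_prod_mk, f, a]
      rw [tsum_mul_left, map_add, Complex.exp_add, ← mul_assoc, Complex.exp_eq_exp_ℂ,
        NormedSpace.exp_eq_tsum_div]
    rw [← hval]
    exact hf.hasSum.prod_fiberwise hin

/-- The series converges uniformly on the torus. If its sum were zero, the `L²` pairing with the
character `n₀` would give `d n₀ = 0`. -/
theorem exists_tsum_mul_cexp_ne_zero {ι : Type*} [Fintype ι] (d : (ι → ℤ) → ℂ) (hd : Summable d)
    (n₀ : ι → ℤ) (h₀ : d n₀ ≠ 0) :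
    ∃ a : ι → ℝ, ∑' n, d n * Complex.exp (2 * Real.pi * Complex.I * ∑ i, (n i : ℂ) * a i) ≠ 0 := by
  by_contra! h
  have hs : Summable fun n => d n • UnitAddTorus.mFourier n := by
    refine Summable.of_norm ?_
    simpa [norm_smul, UnitAddTorus.mFourier_norm] using hd.norm
  have hF : ∑' n, d n • UnitAddTorus.mFourier n = 0 := by
    ext x
    obtain ⟨a, rfl⟩ : ∃ a : ι → ℝ, x = fun i => (a i : UnitAddCircle) :=
      ⟨fun i => (QuotientAddGroup.mk_surjective (x i)).choose,
        funext fun i => ((QuotientAddGroup.mk_surjective (x i)).choose_spec).symm⟩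
    rw [← ContinuousMap.tsum_apply hs]
    simp only [ContinuousMap.zero_apply]
    rw [← h a]
    refine tsum_congr fun n => ?_
    simp only [ContinuousMap.smul_apply, smul_eq_mul, UnitAddTorus.mFourier, ContinuousMap.coe_mk,
      fourier_coe_apply, ← Complex.exp_sum, Finset.mul_sum]
    congr 2
    refine Finset.sum_congr rfl fun i _ => ?_
    simp; ring
  have : MeasureTheory.IsProbabilityMeasure
      (@MeasureTheory.volume UnitAddCircle instMeasureSpaceUnitAddCircle) :=
    inferInstanceAs (MeasureTheory.IsProbabilityMeasure AddCircle.haarAddCircle)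
  have h2 := (hF ▸ hs.hasSum).mapL
    ((innerSL ℂ (UnitAddTorus.mFourierLp (d := ι) 2 n₀)).comp (ContinuousMap.toLp (E := ℂ) 2 _ ℂ))
  have h3 : HasSum (fun n => if n = n₀ then d n else 0) (0 : ℂ) := by
    have := orthonormal_iff_ite.mp (UnitAddTorus.orthonormal_mFourier (d := ι))
    simp only [map_smul, ContinuousLinearMap.comp_apply, innerSL_apply_apply, map_zero,
      smul_eq_mul] at h2
    refine h2.congr_fun fun n => ?_
    have h4 := this n₀ n
    rw [UnitAddTorus.mFourierLp] at h4
    rw [h4]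
    by_cases hn : n = n₀
    · simp [hn]
    · simp [hn, Ne.symm hn]
  exact h₀ ((hasSum_ite_eq n₀ (d n₀)).unique (by
    refine h3.congr_fun fun n => ?_
    split_ifs with hn <;> simp [hn]))

/-! ### Theta series with real characteristics -/

/-- The value `ᵗx S x` of a complex quadratic form at a real vector. -/
def complexQuad {ι : Type*} [Fintype ι] (S : Matrix ι ι ℂ) (x : ι → ℝ) : ℂ :=
  (fun i => (x i : ℂ)) ⬝ᵥ S *ᵥ (fun i => (x i : ℂ))

/-- The translate `n + b` of an integral vector by a real vector. -/
def intShift {ι : Type*} (n : ι → ℤ) (b : ι → ℝ) : ι → ℝ := fun i => (n i : ℝ) + b i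

/-- The general term of the theta series with real characteristic `b`, evaluated at the real
vector `a`. -/
def charTerm {ι : Type*} [Fintype ι] (S : Matrix ι ι ℂ) (a b : ι → ℝ) (n : ι → ℤ) : ℂ :=
  Complex.exp (Real.pi * Complex.I * complexQuad S (intShift n b)
    + 2 * Real.pi * Complex.I * ∑ i, (n i : ℂ) * a i)

section Quad

variable {ι : Type*} [Fintype ι]

theorem im_mulVec_ofReal (S : Matrix ι ι ℂ) (x : ι → ℝ) (i : ι) :
    ((S *ᵥ fun j => (x j : ℂ)) i).im = (S.map Complex.im *ᵥ x) i := by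
  simp [mulVec, dotProduct, Complex.im_sum]

theorem im_complexQuad (S : Matrix ι ι ℂ) (x : ι → ℝ) :
    (complexQuad S x).im = x ⬝ᵥ S.map Complex.im *ᵥ x := by
  simp only [complexQuad, dotProduct, Complex.im_sum, Complex.im_ofReal_mul, im_mulVec_ofReal]

theorem complexQuad_add {S : Matrix ι ι ℂ} (hS : S.IsSymm) (x y : ι → ℝ) :
    complexQuad S (x + y) = complexQuad S x
      + 2 * ((fun i => (x i : ℂ)) ⬝ᵥ S *ᵥ fun i => (y i : ℂ)) + complexQuad S y := by
  have h : (fun i => (y i : ℂ)) ⬝ᵥ S *ᵥ (fun i => (x i : ℂ))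
      = (fun i => (x i : ℂ)) ⬝ᵥ S *ᵥ fun i => (y i : ℂ) := by
    rw [dotProduct_mulVec, ← mulVec_transpose, hS.eq, dotProduct_comm]
  have h2 : (fun i => (((x + y) i : ℝ) : ℂ)) = (fun i => (x i : ℂ)) + fun i => (y i : ℂ) := by
    ext i; simp
  rw [complexQuad, h2, mulVec_add, add_dotProduct, dotProduct_add, dotProduct_add, h,
    complexQuad, complexQuad]
  ring

theorem continuous_complexQuad (x : ι → ℝ) : Continuous fun S : Matrix ι ι ℂ => complexQuad S x := by
  unfold complexQuad
  fun_prop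

theorem norm_charTerm (S : Matrix ι ι ℂ) (a b : ι → ℝ) (n : ι → ℤ) :
    ‖charTerm S a b n‖
      = Real.exp (-(Real.pi * (intShift n b ⬝ᵥ S.map Complex.im *ᵥ intShift n b))) := by
  rw [charTerm, Complex.norm_exp, ← im_complexQuad]
  congr 1
  have h : (∑ i, (n i : ℂ) * a i) = ((∑ i, (n i : ℝ) * a i : ℝ) : ℂ) := by push_cast; rfl
  rw [h]
  simp [Complex.mul_re]

end Quad

/-- At a point with real coordinates `a`, `b`, the normed theta function is the absolute value of
the theta series with real characteristic, up to the factor `det(Im τ)^{1/4}`. -/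
theorem normTheta_add_mulVec {ι : Type} [Fintype ι] [DecidableEq ι] {T : Matrix ι ι ℂ}
    (hT : T ∈ SiegelSpace ι) (a b : ι → ℝ) :
    normTheta T ((fun i => (a i : ℂ)) + T *ᵥ fun i => (b i : ℂ))
      = (T.map Complex.im).det ^ (1 / 4 : ℝ) * ‖∑' n, charTerm T a b n‖ := by
  obtain ⟨hs, hp⟩ := hT
  have him : (fun i => (((fun i => (a i : ℂ)) + T *ᵥ fun i => (b i : ℂ)) i).im)
      = T.map Complex.im *ᵥ b := by
    ext i; simp [im_mulVec_ofReal]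
  have hq : (T.map Complex.im *ᵥ b) ⬝ᵥ (T.map Complex.im)⁻¹ *ᵥ (T.map Complex.im *ᵥ b)
      = b ⬝ᵥ T.map Complex.im *ᵥ b := by
    rw [mulVec_mulVec, nonsing_inv_mul _ ((isUnit_iff_isUnit_det _).mp hp.isUnit), one_mulVec,
      dotProduct_comm]
  -- The Gaussian factor is the modulus of the term `ᵗb T b` missing from the square `ᵗ(n + b) T (n
  -- + b)`.
  have he : Real.exp (-(Real.pi * (b ⬝ᵥ T.map Complex.im *ᵥ b)))
      = ‖Complex.exp (Real.pi * Complex.I * complexQuad T b)‖ := by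
    rw [Complex.norm_exp, ← im_complexQuad]
    simp [Complex.mul_re]
  rw [normTheta, him, hq, he, mul_assoc, ← norm_mul, riemannTheta, ← tsum_mul_left]
  congr 2
  refine tsum_congr fun n => ?_
  rw [← Complex.exp_add, charTerm]
  congr 1
  have h1 : intShift n b = (fun i => (n i : ℝ)) + b := rfl
  rw [h1, complexQuad_add hs, dotProduct_add]
  simp only [complexQuad, dotProduct, Complex.ofReal_intCast]
  ring

/-! ### Shortest vectors and the tropical theta function -/

section Psi

variable {κ : Type} [Fintype κ]

theorem mem_realLattice {B : Matrix κ κ ℝ} {x : κ → ℝ} :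
    x ∈ realLattice B ↔ ∃ k : κ → ℤ, B *ᵥ (fun i => (k i : ℝ)) = x := by
  simp only [realLattice, AddMonoidHom.mem_range]
  rfl

theorem mk_mulVec_intShift (B : Matrix κ κ ℝ) (k : κ → ℤ) (c : κ → ℝ) :
    (QuotientAddGroup.mk (B *ᵥ intShift k c) : RealTorus B) = QuotientAddGroup.mk (B *ᵥ c) := by
  rw [eq_comm, QuotientAddGroup.eq, mem_realLattice]
  refine ⟨k, ?_⟩
  have : intShift k c = c + fun i => (k i : ℝ) := by ext i; simp [intShift, add_comm]
  rw [this, mulVec_add]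
  abel

theorem tendsto_norm_intShift (c : κ → ℝ) :
    Tendsto (fun k : κ → ℤ => ‖intShift k c‖) cofinite atTop := by
  have h1 : Tendsto (fun k : κ → ℤ => ‖k‖) cofinite atTop := by
    rw [← cocompact_eq_cofinite]
    exact tendsto_norm_cocompact_atTop
  refine tendsto_atTop_mono (fun k => ?_) (tendsto_atTop_add_const_right _ (-‖c‖) h1)
  have h2 : ‖k‖ = ‖fun i => (k i : ℝ)‖ := by
    simp only [Pi.norm_def]
    exact congrArg _ (Finset.sup_congr rfl fun i _ => NNReal.eq (Int.norm_cast_real (k i)).symm)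
  have h3 : (fun i => (k i : ℝ)) = intShift k c - c := by ext i; simp [intShift]
  rw [h2, h3]
  linarith [norm_sub_le (intShift k c) c]

variable [DecidableEq κ] {B : Matrix κ κ ℝ}

theorem dotProduct_inv_mulVec_mulVec (hB : B.PosDef) (x : κ → ℝ) :
    (B *ᵥ x) ⬝ᵥ B⁻¹ *ᵥ (B *ᵥ x) = x ⬝ᵥ B *ᵥ x := by
  rw [mulVec_mulVec, nonsing_inv_mul _ ((isUnit_iff_isUnit_det _).mp hB.isUnit), one_mulVec,
    dotProduct_comm]

theorem normPsi_le (hB : B.PosDef) (c : κ → ℝ) (k : κ → ℤ) :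
    2 * normPsi B (QuotientAddGroup.mk (B *ᵥ c)) ≤ intShift k c ⬝ᵥ B *ᵥ intShift k c := by
  have hbdd : BddBelow (Set.range fun y : {y : κ → ℝ //
      (QuotientAddGroup.mk y : RealTorus B) = QuotientAddGroup.mk (B *ᵥ c)} =>
        (1 / 2 : ℝ) * ((y : κ → ℝ) ⬝ᵥ B⁻¹ *ᵥ (y : κ → ℝ))) := by
    refine ⟨0, ?_⟩
    rintro _ ⟨y, rfl⟩
    have := hB.inv.posSemidef.dotProduct_mulVec_nonneg (y : κ → ℝ)
    simp only [star_trivial] at this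
    positivity
  have h := ciInf_le hbdd ⟨B *ᵥ intShift k c, mk_mulVec_intShift B k c⟩
  simp only [dotProduct_inv_mulVec_mulVec hB] at h
  rw [normPsi]
  linarith

/-- The representatives of the class of `B c` are the vectors `B (k + c)`, on which the form of
`B⁻¹` becomes that of `B` at `k + c`. This tends to infinity with `k`, so the infimum is attained.
-/
theorem exists_normPsi_eq (hB : B.PosDef) (c : κ → ℝ) :
    ∃ k : κ → ℤ, intShift k c ⬝ᵥ B *ᵥ intShift k c
      = 2 * normPsi B (QuotientAddGroup.mk (B *ᵥ c)) := by
  obtain ⟨C, hC, hCle⟩ := hB.exists_pos_mul_sq_norm_le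
  have ht : Tendsto (fun k : κ → ℤ => intShift k c ⬝ᵥ B *ᵥ intShift k c) cofinite atTop := by
    refine tendsto_atTop_mono (fun k => hCle _) ?_
    exact ((tendsto_pow_atTop two_ne_zero).comp (tendsto_norm_intShift c)).const_mul_atTop hC
  obtain ⟨k, hk⟩ := ht.exists_forall_le
  refine ⟨k, le_antisymm ?_ (normPsi_le hB c k)⟩
  have : Nonempty {y : κ → ℝ //
      (QuotientAddGroup.mk y : RealTorus B) = QuotientAddGroup.mk (B *ᵥ c)} := ⟨⟨_, rfl⟩⟩
  rw [← div_le_iff₀' two_pos]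
  refine le_ciInf fun y => ?_
  obtain ⟨y, hy⟩ := y
  rw [eq_comm, QuotientAddGroup.eq, mem_realLattice] at hy
  obtain ⟨k', hk'⟩ := hy
  have h2 : y = B *ᵥ intShift k' c := by
    have h3 : intShift k' c = c + fun i => (k' i : ℝ) := by ext i; simp [intShift, add_comm]
    rw [h3, mulVec_add, hk']
    abel
  simp only [h2, dotProduct_inv_mulVec_mulVec hB]
  linarith [hk k']

end Psi

/-! ### The limit of a degenerating theta series -/

theorem abs_dotProduct_mulVec_le {ι κ : Type*} [Fintype ι] [Fintype κ] (E : Matrix ι κ ℝ)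
    (u : ι → ℝ) (v : κ → ℝ) : |u ⬝ᵥ E *ᵥ v| ≤ (∑ i, ∑ j, |E i j|) * (‖u‖ * ‖v‖) := by
  simp only [dotProduct, mulVec, Finset.mul_sum, Finset.sum_mul]
  refine (Finset.abs_sum_le_sum_abs _ _).trans (Finset.sum_le_sum fun i _ => ?_)
  refine (Finset.abs_sum_le_sum_abs _ _).trans (Finset.sum_le_sum fun j _ => ?_)
  rw [abs_mul, abs_mul]
  have h1 := norm_le_pi_norm u i
  have h2 := norm_le_pi_norm v j
  rw [Real.norm_eq_abs] at h1 h2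
  calc |u i| * (|E i j| * |v j|) = |E i j| * (|u i| * |v j|) := by ring
    _ ≤ _ := by gcongr

theorem sq_norm_le_add_sq_norm {κ₁ κ₂ : Type*} [Fintype κ₁] [Fintype κ₂] (x : κ₁ ⊕ κ₂ → ℝ) :
    ‖x‖ ^ 2 ≤ ‖x ∘ Sum.inl‖ ^ 2 + ‖x ∘ Sum.inr‖ ^ 2 := by
  have h : ‖x‖ ≤ max ‖x ∘ Sum.inl‖ ‖x ∘ Sum.inr‖ := by
    refine (pi_norm_le_iff_of_nonneg (le_max_of_le_left (norm_nonneg _))).mpr ?_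
    rintro (i | i)
    · exact le_max_of_le_left (norm_le_pi_norm (x ∘ Sum.inl) i)
    · exact le_max_of_le_right (norm_le_pi_norm (x ∘ Sum.inr) i)
  rcases le_max_iff.mp h with h | h <;>
    nlinarith [sq_nonneg ‖x ∘ Sum.inl‖, sq_nonneg ‖x ∘ Sum.inr‖, norm_nonneg x]

theorem dotProduct_fromBlocks_mulVec {R κ₁ κ₂ : Type*} [CommRing R] [Fintype κ₁] [Fintype κ₂]
    (A : Matrix κ₁ κ₁ R) (C : Matrix κ₁ κ₂ R) (C' : Matrix κ₂ κ₁ R) (D : Matrix κ₂ κ₂ R)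
    (x : κ₁ ⊕ κ₂ → R) :
    x ⬝ᵥ fromBlocks A C C' D *ᵥ x
      = (x ∘ Sum.inl) ⬝ᵥ A *ᵥ (x ∘ Sum.inl) + (x ∘ Sum.inl) ⬝ᵥ C *ᵥ (x ∘ Sum.inr)
        + ((x ∘ Sum.inr) ⬝ᵥ C' *ᵥ (x ∘ Sum.inl) + (x ∘ Sum.inr) ⬝ᵥ D *ᵥ (x ∘ Sum.inr)) := by
  rw [fromBlocks_mulVec, ← Sum.elim_comp_inl_inr x, sumElim_dotProduct_sumElim,
    dotProduct_add, dotProduct_add]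
  simp

section Degeneration

variable {κ₁ κ₂ : Type} [Fintype κ₁] [Fintype κ₂]

/-- Only the upper left block of `Y` is known to be positive. A large multiple of `B` absorbs the
cross terms and the lower block; this supplies the uniform Gaussian decay behind all later
domination arguments. -/
theorem exists_coercive {Y : Matrix (κ₁ ⊕ κ₂) (κ₁ ⊕ κ₂) ℝ} (hY : Y.toBlocks₁₁.PosDef)
    {B : Matrix κ₂ κ₂ ℝ} (hB : B.PosDef) :
    ∃ y₀ : ℝ, ∃ δ > 0, ∀ x : κ₁ ⊕ κ₂ → ℝ,
      δ * ‖x‖ ^ 2 ≤ x ⬝ᵥ Y *ᵥ x + y₀ * ((x ∘ Sum.inr) ⬝ᵥ B *ᵥ (x ∘ Sum.inr)) := by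
  obtain ⟨c₁, hc₁, h₁⟩ := hY.exists_pos_mul_sq_norm_le
  obtain ⟨c₂, hc₂, h₂⟩ := hB.exists_pos_mul_sq_norm_le
  set K₁₂ := ∑ i, ∑ j, |Y.toBlocks₁₂ i j| with hK₁₂
  set K₂₁ := ∑ i, ∑ j, |Y.toBlocks₂₁ i j| with hK₂₁
  set K₂₂ := ∑ i, ∑ j, |Y.toBlocks₂₂ i j| with hK₂₂
  have hK0 : 0 ≤ K₂₂ := Finset.sum_nonneg fun i _ => Finset.sum_nonneg fun j _ => abs_nonneg _
  set K := K₁₂ + K₂₁ with hK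
  -- `K² / (2c₁)` pays for the cross terms after Young's inequality, `K₂₂` for the lower block, and
  -- the last `c₁ / 2` provides the decay in the last coordinates.
  refine ⟨(K ^ 2 / (2 * c₁) + K₂₂ + c₁ / 2) / c₂, c₁ / 2, by positivity, fun x => ?_⟩
  have hx := dotProduct_fromBlocks_mulVec Y.toBlocks₁₁ Y.toBlocks₁₂ Y.toBlocks₂₁ Y.toBlocks₂₂ x
  rw [fromBlocks_toBlocks] at hx
  have e₁ := h₁ (x ∘ Sum.inl)
  have e₂ := h₂ (x ∘ Sum.inr)
  have e₁₂ := (abs_le.mp (abs_dotProduct_mulVec_le Y.toBlocks₁₂ (x ∘ Sum.inl) (x ∘ Sum.inr))).1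
  have e₂₁ := (abs_le.mp (abs_dotProduct_mulVec_le Y.toBlocks₂₁ (x ∘ Sum.inr) (x ∘ Sum.inl))).1
  have e₂₂ := (abs_le.mp (abs_dotProduct_mulVec_le Y.toBlocks₂₂ (x ∘ Sum.inr) (x ∘ Sum.inr))).1
  have e₃ := sq_norm_le_add_sq_norm x
  rw [← hK₁₂] at e₁₂
  rw [← hK₂₁] at e₂₁
  rw [← hK₂₂] at e₂₂
  set s := ‖x ∘ Sum.inl‖
  set t := ‖x ∘ Sum.inr‖
  have e₄ : (K ^ 2 / (2 * c₁) + K₂₂ + c₁ / 2) * t ^ 2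
      ≤ (K ^ 2 / (2 * c₁) + K₂₂ + c₁ / 2) / c₂ * ((x ∘ Sum.inr) ⬝ᵥ B *ᵥ (x ∘ Sum.inr)) := by
    rw [div_mul_eq_mul_div, le_div_iff₀ hc₂, mul_assoc]
    gcongr
    linarith
  have e₅ : K * (s * t) ≤ c₁ / 2 * s ^ 2 + K ^ 2 / (2 * c₁) * t ^ 2 := by
    have h5 : c₁ / 2 * s ^ 2 + K ^ 2 / (2 * c₁) * t ^ 2 - K * (s * t)
        = c₁ / 2 * (s - K / c₁ * t) ^ 2 := by field_simp; ring
    have h6 : 0 ≤ c₁ / 2 * (s - K / c₁ * t) ^ 2 := by positivity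
    linarith
  have e₆ : c₁ / 2 * ‖x‖ ^ 2 ≤ c₁ / 2 * (s ^ 2 + t ^ 2) := by gcongr
  rw [hK] at e₅ e₄ ⊢
  rw [hx]
  linarith

theorem eventually_abs_dotProduct_sub_le {W ι : Type*} [Fintype ι] {l : Filter W}
    {Y : W → Matrix ι ι ℝ} {Y₀ : Matrix ι ι ℝ} (h : Tendsto Y l (𝓝 Y₀)) {δ : ℝ} (hδ : 0 < δ) :
    ∀ᶠ w in l, ∀ x : ι → ℝ, x ⬝ᵥ Y₀ *ᵥ x - δ * ‖x‖ ^ 2 ≤ x ⬝ᵥ Y w *ᵥ x := by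
  have h1 : Tendsto (fun w => ∑ i, ∑ j, |(Y w - Y₀) i j|) l (𝓝 0) := by
    have h2 : Continuous fun M : Matrix ι ι ℝ => ∑ i, ∑ j, |(M - Y₀) i j| := by fun_prop
    simpa [Function.comp_def] using (h2.tendsto Y₀).comp h
  filter_upwards [h1.eventually (gt_mem_nhds hδ)] with w hw x
  have h3 := (abs_le.mp (abs_dotProduct_mulVec_le (Y w - Y₀) x x)).1
  rw [sub_mulVec, dotProduct_sub] at h3
  have h4 : (∑ i, ∑ j, |(Y w - Y₀) i j|) * (‖x‖ * ‖x‖) ≤ δ * ‖x‖ ^ 2 := by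
    rw [sq]; gcongr
  linarith

theorem summable_exp_neg_sq_norm_intShift {ι : Type*} [Fintype ι] {δ : ℝ} (hδ : 0 < δ)
    (b : ι → ℝ) (R : ℝ) :
    Summable fun n : ι → ℤ =>
      Real.exp (-(δ * ‖intShift n b‖ ^ 2) + R * ∑ i, |(n i : ℝ)|) := by
  -- Dividing by the cardinality passes from the sup norm to the sum of squares; the `+ 1` covers
  -- the empty index type.
  set δ' := δ / (Fintype.card ι + 1) with hδ'
  have hδ'0 : 0 < δ' := by positivity
  refine Summable.of_nonneg_of_le (fun n => (Real.exp_pos _).le) (fun n => ?_)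
    (summable_exp_neg_quadratic (ι := ι) hδ'0 (R + 2 * δ' * ‖b‖))
  refine Real.exp_le_exp.mpr ?_
  have h1 : δ' * ∑ i, (intShift n b i) ^ 2 ≤ δ * ‖intShift n b‖ ^ 2 := by
    have := dotProduct_self_le_card_mul_sq_norm (intShift n b)
    simp only [dotProduct, ← sq] at this
    rw [hδ', div_mul_eq_mul_div, div_le_iff₀ (by positivity), mul_assoc]
    gcongr
    nlinarith [sq_nonneg ‖intShift n b‖]
  have h2 : ∑ i, ((n i : ℝ) ^ 2 - 2 * ‖b‖ * |(n i : ℝ)|) ≤ ∑ i, (intShift n b i) ^ 2 := by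
    refine Finset.sum_le_sum fun i _ => ?_
    have hb := norm_le_pi_norm b i
    rw [Real.norm_eq_abs] at hb
    have h3 : |(n i : ℝ) * b i| ≤ |(n i : ℝ)| * ‖b‖ := by
      rw [abs_mul]; gcongr
    have h4 := (abs_le.mp h3).1
    simp only [intShift]
    nlinarith [sq_nonneg (b i)]
  rw [Finset.sum_sub_distrib, ← Finset.mul_sum] at h2
  have h3 := mul_le_mul_of_nonneg_left h2 hδ'0.le
  linarith

variable [DecidableEq κ₂]

/-- The general term of the limit theta series: only the vectors `n` for which the last
coordinates of `n + b` are shortest for `B` contribute. -/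
def limitTerm (B : Matrix κ₂ κ₂ ℝ) (S : Matrix (κ₁ ⊕ κ₂) (κ₁ ⊕ κ₂) ℂ) (a b : κ₁ ⊕ κ₂ → ℝ)
    (n : κ₁ ⊕ κ₂ → ℤ) : ℂ :=
  if (intShift n b ∘ Sum.inr) ⬝ᵥ B *ᵥ (intShift n b ∘ Sum.inr)
      = 2 * normPsi B (QuotientAddGroup.mk (B *ᵥ (b ∘ Sum.inr))) then charTerm S a b n else 0

/-- On the contributing vectors the form of `B` is constant, equal to its minimum, so coercivity
costs only the constant `C`. -/
theorem exists_norm_limitTerm_le {S : Matrix (κ₁ ⊕ κ₂) (κ₁ ⊕ κ₂) ℂ}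
    (hS : (S.map Complex.im).toBlocks₁₁.PosDef) {B : Matrix κ₂ κ₂ ℝ} (hB : B.PosDef)
    (b : κ₁ ⊕ κ₂ → ℝ) :
    ∃ δ > 0, ∃ C : ℝ, ∀ a n, ‖limitTerm B S a b n‖
      ≤ Real.exp (C + -(δ * ‖intShift n b‖ ^ 2)) := by
  obtain ⟨y₀, δ, hδ, h⟩ := exists_coercive hS hB
  refine ⟨Real.pi * δ, by positivity,
    Real.pi * (y₀ * (2 * normPsi B (QuotientAddGroup.mk (B *ᵥ (b ∘ Sum.inr))))), fun a n => ?_⟩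
  rw [limitTerm]
  split_ifs with hn
  · rw [norm_charTerm]
    refine Real.exp_le_exp.mpr ?_
    have h1 := mul_le_mul_of_nonneg_left (h (intShift n b)) Real.pi_pos.le
    rw [← hn]
    linarith
  · rw [norm_zero]
    exact (Real.exp_pos _).le

/-- Subtracting the minimum makes the exponent of every term nonnegative against `Im z`: zero on
shortest vectors, strictly positive otherwise. For `Im z ≥ y₀` the coercive estimate dominates all
terms at once; replacing `S w` by its limit uses up half of `δ`. -/
theorem tendsto_tsum_charTerm {W : Type*} {l : Filter W} {z : W → ℂ}
    {S : W → Matrix (κ₁ ⊕ κ₂) (κ₁ ⊕ κ₂) ℂ} {S₀ : Matrix (κ₁ ⊕ κ₂) (κ₁ ⊕ κ₂) ℂ}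
    (hz : Tendsto (fun w => (z w).im) l atTop) (hS : Tendsto S l (𝓝 S₀))
    (hS₀ : (S₀.map Complex.im).toBlocks₁₁.PosDef) {B : Matrix κ₂ κ₂ ℝ} (hB : B.PosDef)
    (a b : κ₁ ⊕ κ₂ → ℝ) :
    Tendsto (fun w => ∑' n, Complex.exp (Real.pi * Complex.I * (z w *
        (((intShift n b ∘ Sum.inr) ⬝ᵥ B *ᵥ (intShift n b ∘ Sum.inr)
          - 2 * normPsi B (QuotientAddGroup.mk (B *ᵥ (b ∘ Sum.inr))) : ℝ) : ℂ)))
        * charTerm (S w) a b n) l (𝓝 (∑' n, limitTerm B S₀ a b n)) := by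
  obtain ⟨y₀, δ, hδ, hcoer⟩ := exists_coercive hS₀ hB
  set μ := 2 * normPsi B (QuotientAddGroup.mk (B *ᵥ (b ∘ Sum.inr))) with hμ
  have hnonneg : ∀ n : κ₁ ⊕ κ₂ → ℤ,
      0 ≤ (intShift n b ∘ Sum.inr) ⬝ᵥ B *ᵥ (intShift n b ∘ Sum.inr) - μ := fun n =>
    sub_nonneg.mpr (normPsi_le hB (b ∘ Sum.inr) (n ∘ Sum.inr))
  have hnorm : ∀ w (r : ℝ), ‖Complex.exp (Real.pi * Complex.I * (z w * (r : ℂ)))‖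
      = Real.exp (-(Real.pi * ((z w).im * r))) := by
    intro w r
    rw [Complex.norm_exp]
    simp [Complex.mul_re]
  have hchar : ∀ n, Tendsto (fun w => charTerm (S w) a b n) l (𝓝 (charTerm S₀ a b n)) := by
    intro n
    have : Continuous fun M => charTerm M a b n := by
      unfold charTerm
      have := continuous_complexQuad (intShift n b)
      fun_prop
    exact (this.tendsto S₀).comp hS
  have him : Tendsto (fun w => (S w).map Complex.im) l (𝓝 (S₀.map Complex.im)) :=
    ((Continuous.matrix_map continuous_id Complex.continuous_im).tendsto S₀).comp hS
  refine tendsto_tsum_of_dominated_convergence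
    (bound := fun n => Real.exp (Real.pi * (y₀ * μ))
      * Real.exp (-(Real.pi * (δ / 2) * ‖intShift n b‖ ^ 2) + 0 * ∑ i, |(n i : ℝ)|))
    ((summable_exp_neg_sq_norm_intShift (by positivity) b 0).mul_left _) (fun n => ?_) ?_
  · rw [limitTerm, ← hμ]
    split_ifs with hn
    · simpa [hn] using hchar n
    · have hpos := lt_of_le_of_ne (hnonneg n) (sub_ne_zero.mpr hn).symm
      rw [← zero_mul (charTerm S₀ a b n)]
      refine Tendsto.mul ?_ (hchar n)
      rw [tendsto_zero_iff_norm_tendsto_zero]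
      simp_rw [hnorm]
      refine Real.tendsto_exp_atBot.comp (tendsto_neg_atTop_atBot.comp ?_)
      exact (hz.atTop_mul_const hpos).const_mul_atTop Real.pi_pos
  · filter_upwards [hz.eventually_ge_atTop y₀,
      eventually_abs_dotProduct_sub_le him (half_pos hδ)] with w hw hE n
    rw [norm_mul, hnorm, norm_charTerm, ← Real.exp_add, ← Real.exp_add]
    refine Real.exp_le_exp.mpr ?_
    have h1 := mul_le_mul_of_nonneg_right hw (hnonneg n)
    have h2 := hcoer (intShift n b)
    have h3 := hE (intShift n b)
    have h4 : δ / 2 * ‖intShift n b‖ ^ 2 - y₀ * μ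
        ≤ (z w).im * ((intShift n b ∘ Sum.inr) ⬝ᵥ B *ᵥ (intShift n b ∘ Sum.inr) - μ)
          + intShift n b ⬝ᵥ (S w).map Complex.im *ᵥ intShift n b := by linarith
    have h5 := mul_le_mul_of_nonneg_left h4 Real.pi_pos.le
    linarith

end Degeneration

section Degeneration

variable {κ₁ κ₂ : Type} [Fintype κ₁] [Fintype κ₂]

theorem complexQuad_fromBlocks_smul_add (A : Matrix κ₁ κ₁ ℂ) (C : Matrix κ₁ κ₂ ℂ)
    (C' : Matrix κ₂ κ₁ ℂ) (D : Matrix κ₂ κ₂ ℂ) (B : Matrix κ₂ κ₂ ℝ) (z : ℂ) (x : κ₁ ⊕ κ₂ → ℝ) :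
    complexQuad (fromBlocks A C C' (z • B.map (fun r => (r : ℂ)) + D)) x
      = z * (((x ∘ Sum.inr) ⬝ᵥ B *ᵥ (x ∘ Sum.inr) : ℝ) : ℂ)
        + complexQuad (fromBlocks A C C' D) x := by
  rw [complexQuad, complexQuad, dotProduct_fromBlocks_mulVec, dotProduct_fromBlocks_mulVec,
    add_mulVec, dotProduct_add, smul_mulVec, dotProduct_smul, smul_eq_mul]
  have h : ((fun i => (x i : ℂ)) ∘ Sum.inr) ⬝ᵥ B.map (fun r => (r : ℂ)) *ᵥ
      ((fun i => (x i : ℂ)) ∘ Sum.inr) = (((x ∘ Sum.inr) ⬝ᵥ B *ᵥ (x ∘ Sum.inr) : ℝ) : ℂ) := by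
    simp [dotProduct, mulVec]
  rw [h]
  ring

/-- The theta series of a degenerating matrix, rescaled by its largest exponential. -/
theorem exp_mul_norm_tsum_charTerm (A : Matrix κ₁ κ₁ ℂ) (C : Matrix κ₁ κ₂ ℂ)
    (C' : Matrix κ₂ κ₁ ℂ) (D : Matrix κ₂ κ₂ ℂ) (B : Matrix κ₂ κ₂ ℝ) (z : ℂ) (a b : κ₁ ⊕ κ₂ → ℝ)
    (μ : ℝ) :
    Real.exp (Real.pi * (z.im * μ))
        * ‖∑' n, charTerm (fromBlocks A C C' (z • B.map (fun r => (r : ℂ)) + D)) a b n‖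
      = ‖∑' n, Complex.exp (Real.pi * Complex.I * (z *
        (((intShift n b ∘ Sum.inr) ⬝ᵥ B *ᵥ (intShift n b ∘ Sum.inr) - μ : ℝ) : ℂ)))
        * charTerm (fromBlocks A C C' D) a b n‖ := by
  have h : Real.exp (Real.pi * (z.im * μ))
      = ‖Complex.exp (-(Real.pi * Complex.I * (z * (μ : ℂ))))‖ := by
    rw [Complex.norm_exp]
    simp [Complex.mul_re]
  rw [h, ← norm_mul, ← tsum_mul_left]
  congr 1
  refine tsum_congr fun n => ?_
  rw [charTerm, charTerm, complexQuad_fromBlocks_smul_add, ← Complex.exp_add, ← Complex.exp_add]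
  congr 1
  push_cast
  ring

variable [DecidableEq κ₂]

/-- Dividing the lower block of rows by `y` makes the matrix converge to a block triangular one with
diagonal blocks `L₁` and `B`. -/
theorem tendsto_det_div_pow [DecidableEq κ₁] {W : Type*} {l : Filter W} {y : W → ℝ}
    {Y₁ : W → Matrix κ₁ κ₁ ℝ} {Y₃ : W → Matrix κ₁ κ₂ ℝ} {Y₃' : W → Matrix κ₂ κ₁ ℝ}
    {Y₂ : W → Matrix κ₂ κ₂ ℝ} {B L₂ : Matrix κ₂ κ₂ ℝ} {L₁ : Matrix κ₁ κ₁ ℝ}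
    {L₃ : Matrix κ₁ κ₂ ℝ} {L₃' : Matrix κ₂ κ₁ ℝ} (hy : Tendsto y l atTop)
    (h₁ : Tendsto Y₁ l (𝓝 L₁)) (h₃ : Tendsto Y₃ l (𝓝 L₃)) (h₃' : Tendsto Y₃' l (𝓝 L₃'))
    (h₂ : Tendsto Y₂ l (𝓝 L₂)) :
    Tendsto (fun w => (fromBlocks (Y₁ w) (Y₃ w) (Y₃' w) (y w • B + Y₂ w)).det
      / y w ^ Fintype.card κ₂) l (𝓝 (L₁.det * B.det)) := by
  have hinv : Tendsto (fun w => (y w)⁻¹) l (𝓝 0) := tendsto_inv_atTop_zero.comp hy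
  have hm : Tendsto (fun w => fromBlocks (Y₁ w) (Y₃ w) ((y w)⁻¹ • Y₃' w) (B + (y w)⁻¹ • Y₂ w)) l
      (𝓝 (fromBlocks L₁ L₃ ((0 : ℝ) • L₃') (B + (0 : ℝ) • L₂))) := by
    have hc : Continuous fun p : Matrix κ₁ κ₁ ℝ × Matrix κ₁ κ₂ ℝ × Matrix κ₂ κ₁ ℝ ×
        Matrix κ₂ κ₂ ℝ => fromBlocks p.1 p.2.1 p.2.2.1 p.2.2.2 :=
      Continuous.matrix_fromBlocks (by fun_prop) (by fun_prop) (by fun_prop) (by fun_prop)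
    exact (hc.tendsto _).comp (h₁.prodMk_nhds (h₃.prodMk_nhds
      ((hinv.smul h₃').prodMk_nhds ((hinv.smul h₂).const_add B))))
  have hd := ((continuous_id.matrix_det (n := κ₁ ⊕ κ₂) (R := ℝ)).tendsto _).comp hm
  simp only [zero_smul, add_zero, id, det_fromBlocks_zero₂₁] at hd
  refine hd.congr' ?_
  filter_upwards [hy.eventually_gt_atTop 0] with w hw
  have hmul : fromBlocks (Y₁ w) (Y₃ w) ((y w)⁻¹ • Y₃' w) (B + (y w)⁻¹ • Y₂ w)
      = fromBlocks 1 0 0 ((y w)⁻¹ • 1) * fromBlocks (Y₁ w) (Y₃ w) (Y₃' w) (y w • B + Y₂ w) := by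
    rw [fromBlocks_multiply]
    simp [smul_smul, inv_mul_cancel₀ hw.ne']
  simp only [Function.comp_apply]
  rw [hmul, det_mul, det_fromBlocks_zero₂₁, det_one, det_smul, det_one, inv_pow]
  field_simp

/-- The limit theta series, as a function of the real coordinates. -/
def limitTheta (B : Matrix κ₂ κ₂ ℝ) (S : Matrix (κ₁ ⊕ κ₂) (κ₁ ⊕ κ₂) ℂ) (a b : κ₁ ⊕ κ₂ → ℝ) : ℂ :=
  ∑' n, limitTerm B S a b n

/-- Gaussian decay beats `exp(R ∑ |n i|)` for every `R`, as the analyticity criterion for series of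
exponentials requires. -/
theorem summable_limitTerm {S : Matrix (κ₁ ⊕ κ₂) (κ₁ ⊕ κ₂) ℂ}
    (hS : (S.map Complex.im).toBlocks₁₁.PosDef) {B : Matrix κ₂ κ₂ ℝ} (hB : B.PosDef)
    (a b : κ₁ ⊕ κ₂ → ℝ) (R : ℝ) :
    Summable fun n => ‖limitTerm B S a b n‖ * Real.exp (R * ∑ i, |(n i : ℝ)|) := by
  obtain ⟨δ, hδ, C, h⟩ := exists_norm_limitTerm_le hS hB b
  refine Summable.of_nonneg_of_le (fun n => by positivity) (fun n => ?_)
    ((summable_exp_neg_sq_norm_intShift hδ b R).mul_left (Real.exp C))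
  rw [Real.exp_add (-_), ← mul_assoc, ← Real.exp_add C]
  gcongr
  exact h a n

/-- In `a` this is an absolutely convergent Fourier series; its coefficient at `(0, k)`, with `k +
c` shortest for `c` the last coordinates of `b`, is an exponential. -/
theorem exists_limitTheta_ne_zero {S : Matrix (κ₁ ⊕ κ₂) (κ₁ ⊕ κ₂) ℂ}
    (hS : (S.map Complex.im).toBlocks₁₁.PosDef) {B : Matrix κ₂ κ₂ ℝ} (hB : B.PosDef)
    (b : κ₁ ⊕ κ₂ → ℝ) : ∃ a, limitTheta B S a b ≠ 0 := by
  obtain ⟨k, hk⟩ := exists_normPsi_eq hB (b ∘ Sum.inr)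
  have hterm : ∀ a n, limitTerm B S a b n = limitTerm B S 0 b n
      * Complex.exp (2 * Real.pi * Complex.I * ∑ i, (n i : ℂ) * a i) := by
    intro a n
    simp only [limitTerm, charTerm]
    split_ifs
    · rw [← Complex.exp_add]
      simp
    · simp
  obtain ⟨a, ha⟩ := exists_tsum_mul_cexp_ne_zero (fun n => limitTerm B S 0 b n)
    (Summable.of_norm (by simpa using summable_limitTerm hS hB 0 b 0)) (Sum.elim 0 k) (by
      have : intShift (Sum.elim 0 k) b ∘ Sum.inr = intShift k (b ∘ Sum.inr) := rfl
      simp only [limitTerm]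
      rw [this, if_pos hk]
      exact Complex.exp_ne_zero _)
  exact ⟨a, by simpa only [limitTheta, hterm a] using ha⟩

/-- The absolute value of the limit theta series only depends on the last coordinates of `b`
modulo integers, the first ones being fixed. -/
theorem norm_limitTheta_add_int (B : Matrix κ₂ κ₂ ℝ) (S : Matrix (κ₁ ⊕ κ₂) (κ₁ ⊕ κ₂) ℂ)
    (a b : κ₁ ⊕ κ₂ → ℝ) (k : κ₁ ⊕ κ₂ → ℤ) :
    ‖limitTheta B S a (intShift k b)‖ = ‖limitTheta B S a b‖ := by
  have hterm : ∀ n, limitTerm B S a b (n + k)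
      = Complex.exp (2 * Real.pi * Complex.I * ∑ i, (k i : ℂ) * a i)
        * limitTerm B S a (intShift k b) n := by
    intro n
    have h1 : intShift (n + k) b = intShift n (intShift k b) := by
      ext i; simp [intShift, add_assoc]
    have h2 : (QuotientAddGroup.mk (B *ᵥ (intShift k b ∘ Sum.inr)) : RealTorus B)
        = QuotientAddGroup.mk (B *ᵥ (b ∘ Sum.inr)) :=
      mk_mulVec_intShift B (k ∘ Sum.inr) (b ∘ Sum.inr)
    simp only [limitTerm, h1, h2, charTerm]
    split_ifs
    · rw [← Complex.exp_add]
      congr 1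
      simp only [Pi.add_apply, Int.cast_add, add_mul, Finset.sum_add_distrib]
      ring
    · simp
  have h3 : ‖Complex.exp (2 * Real.pi * Complex.I * ∑ i, (k i : ℂ) * a i)‖ = 1 := by
    have h : (2 * Real.pi * Complex.I * ∑ i, (k i : ℂ) * a i)
        = ((2 * Real.pi * ∑ i, (k i : ℝ) * a i : ℝ) : ℂ) * Complex.I := by push_cast; ring
    rw [h, Complex.norm_exp_ofReal_mul_I]
  rw [limitTheta, limitTheta, ← (Equiv.addRight k).tsum_eq fun n => limitTerm B S a b n]
  simp only [Equiv.coe_addRight, hterm]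
  rw [tsum_mul_left, norm_mul, h3, one_mul]

/-- For fixed last coordinates `c` of `b`, the limit theta series is real analytic. -/
theorem analyticAt_limitTheta {S : Matrix (κ₁ ⊕ κ₂) (κ₁ ⊕ κ₂) ℂ} (hsymm : S.IsSymm)
    (hS : (S.map Complex.im).toBlocks₁₁.PosDef) {B : Matrix κ₂ κ₂ ℝ} (hB : B.PosDef)
    (c : κ₂ → ℝ) (p₀ : (κ₁ ⊕ κ₂ → ℝ) × (κ₁ ⊕ κ₂ → ℝ)) :
    AnalyticAt ℝ (fun p : (κ₁ ⊕ κ₂ → ℝ) × (κ₁ ⊕ κ₂ → ℝ) =>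
      limitTheta B S p.1 (Sum.elim (p.2 ∘ Sum.inl) c)) p₀ := by
  set b₀ : κ₁ ⊕ κ₂ → ℝ := Sum.elim 0 c with hb₀
  -- `J` is `b₁` padded by zeros and `b₀` is `c` padded by zeros. Expanding the form at `n + b₀ +
  -- J`, the part independent of `n` goes into `pre`, the part linear in `n` into `ell n`, and the
  -- form at `n + b₀` stays as a constant coefficient.
  let J : (κ₁ ⊕ κ₂) → ((κ₁ ⊕ κ₂ → ℝ) × (κ₁ ⊕ κ₂ → ℝ)) →L[ℝ] ℂ := Sum.elim
    (fun i => Complex.ofRealCLM.comp ((ContinuousLinearMap.proj (Sum.inl i)).comp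
      (ContinuousLinearMap.snd ℝ _ _))) 0
  let lam : (κ₁ ⊕ κ₂) → ((κ₁ ⊕ κ₂ → ℝ) × (κ₁ ⊕ κ₂ → ℝ)) →L[ℝ] ℂ := fun i =>
    (2 * Real.pi * Complex.I) • (Complex.ofRealCLM.comp ((ContinuousLinearMap.proj i).comp
      (ContinuousLinearMap.fst ℝ _ _)) + ∑ j, S i j • J j)
  let ell : (κ₁ ⊕ κ₂ → ℤ) → ((κ₁ ⊕ κ₂ → ℝ) × (κ₁ ⊕ κ₂ → ℝ)) →L[ℝ] ℂ := fun n =>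
    ∑ i, (n i : ℝ) • lam i
  let pre : ((κ₁ ⊕ κ₂ → ℝ) × (κ₁ ⊕ κ₂ → ℝ)) → ℂ := fun p =>
    Real.pi * Complex.I * (∑ i, J i p * ∑ j, S i j * J j p)
      + 2 * Real.pi * Complex.I * ∑ i, (b₀ i : ℂ) * ∑ j, S i j * J j p
  have hJ : ∀ (p : (κ₁ ⊕ κ₂ → ℝ) × (κ₁ ⊕ κ₂ → ℝ)) i,
      J i p = ((Sum.elim (p.2 ∘ Sum.inl) 0 : κ₁ ⊕ κ₂ → ℝ) i : ℂ) := by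
    rintro p (i | i) <;> simp [J]
  have hell : ∀ n p, ell n p = 2 * Real.pi * Complex.I * ∑ i, (n i : ℂ) * p.1 i
      + 2 * Real.pi * Complex.I * ∑ i, (n i : ℂ) * ∑ j, S i j * J j p := by
    intro n p
    simp only [ell, lam, _root_.sum_apply, _root_.smul_apply,
      _root_.add_apply, ContinuousLinearMap.comp_apply, smul_eq_mul,
      Complex.real_smul, Complex.ofReal_intCast, Finset.mul_sum, ContinuousLinearMap.proj_apply,
      ContinuousLinearMap.coe_fst', Complex.ofRealCLM_apply, mul_add, Finset.sum_add_distrib]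
    congr 1
    · exact Finset.sum_congr rfl fun i _ => by ring
    · exact Finset.sum_congr rfl fun i _ => Finset.sum_congr rfl fun j _ => by ring
  have hterm : ∀ p n, limitTerm B S p.1 (Sum.elim (p.2 ∘ Sum.inl) c) n
      = Complex.exp (pre p) * (limitTerm B S 0 b₀ n * Complex.exp (ell n p)) := by
    intro p n
    have h1 : intShift n (Sum.elim (p.2 ∘ Sum.inl) c)
        = intShift n b₀ + Sum.elim (p.2 ∘ Sum.inl) 0 := by
      ext (i | i) <;> simp [intShift, hb₀]
    have h2 : intShift n (Sum.elim (p.2 ∘ Sum.inl) c) ∘ Sum.inr = intShift n b₀ ∘ Sum.inr := by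
      ext i; simp [intShift, hb₀]
    have h3 : (Sum.elim (p.2 ∘ Sum.inl) c ∘ Sum.inr : κ₂ → ℝ) = b₀ ∘ Sum.inr := by
      ext i; simp [hb₀]
    simp only [limitTerm, h2, h3, charTerm]
    split_ifs
    · rw [← Complex.exp_add, ← Complex.exp_add, h1, complexQuad_add hsymm, hell]
      congr 1
      have h4 : (fun i => ((intShift n b₀ i : ℝ) : ℂ))
          = (fun i => (n i : ℂ)) + fun i => (b₀ i : ℂ) := by
        ext i; simp [intShift]
      rw [h4, add_dotProduct]
      simp only [pre, hJ, complexQuad, dotProduct, mulVec, Pi.zero_apply, Complex.ofReal_zero,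
        mul_zero, Finset.sum_const_zero]
      ring
    · simp
  have hfun : (fun p : (κ₁ ⊕ κ₂ → ℝ) × (κ₁ ⊕ κ₂ → ℝ) =>
      limitTheta B S p.1 (Sum.elim (p.2 ∘ Sum.inl) c)) = fun p =>
        Complex.exp (pre p) * ∑' n, limitTerm B S 0 b₀ n * Complex.exp (ell n p) := by
    ext p
    rw [limitTheta, ← tsum_mul_left]
    exact tsum_congr (hterm p)
  rw [hfun]
  have hJa : ∀ i, AnalyticAt ℝ (fun p => J i p) p₀ := fun i => (J i).analyticAt p₀
  have hpre : AnalyticAt ℝ pre p₀ := by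
    have h1 : ∀ i, AnalyticAt ℝ (fun p => ∑ j, S i j * J j p) p₀ := fun i =>
      Finset.analyticAt_fun_sum _ fun j _ => analyticAt_const.mul (hJa j)
    exact (analyticAt_const.mul (Finset.analyticAt_fun_sum _ fun i _ => (hJa i).mul (h1 i))).add
      (analyticAt_const.mul (Finset.analyticAt_fun_sum _ fun i _ => analyticAt_const.mul (h1 i)))
  refine AnalyticAt.mul ?_ (analyticAt_tsum_mul_cexp _ ell (fun R => ?_) p₀)
  · exact (analyticAt_cexp (z := pre p₀)).restrictScalars.comp hpre
  · refine Summable.of_nonneg_of_le (fun n => by positivity) (fun n => ?_)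
      (summable_limitTerm hS hB 0 b₀ (|R| * ∑ i, ‖lam i‖))
    gcongr ?_ * Real.exp ?_
    rw [mul_assoc]
    refine (mul_le_mul_of_nonneg_right (le_abs_self R) (norm_nonneg _)).trans ?_
    gcongr
    refine (norm_sum_le _ _).trans ?_
    rw [Finset.mul_sum]
    refine Finset.sum_le_sum fun i _ => ?_
    rw [norm_smul, Real.norm_eq_abs, mul_comm]
    gcongr
    exact Finset.single_le_sum (f := fun i => ‖lam i‖) (fun _ _ => norm_nonneg _)
      (Finset.mem_univ i)

end Degeneration

/-! ### The approach to the puncture on the universal covering -/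

theorem norm_nome (w : ℂ) : ‖nome w‖ = Real.exp (-(2 * Real.pi * w.im)) := by
  rw [nome, Complex.norm_exp]
  simp [Complex.mul_re]

theorem log_norm_nome (w : ℂ) : Real.log ‖nome w‖ = -(2 * Real.pi * w.im) := by
  rw [norm_nome, Real.log_exp]

theorem exists_nome_eq {s : ℂ} (hs : s ≠ 0) (hs' : s ∈ Metric.ball (0 : ℂ) 1) :
    ∃ w : ℂ, 0 < w.im ∧ nome w = s := by
  obtain ⟨w, hw⟩ : ∃ w, nome w = s := by
    refine ⟨Complex.log s / (2 * Real.pi * Complex.I), ?_⟩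
    rw [nome, mul_div_cancel₀ _ Complex.two_pi_I_ne_zero, Complex.exp_log hs]
  refine ⟨w, ?_, hw⟩
  rw [mem_ball_zero_iff, ← hw, norm_nome, Real.exp_lt_one_iff, neg_lt_zero] at hs'
  exact pos_of_mul_pos_right hs' (by positivity)

/-- `‖nome w‖` depends on `Im w` alone, so a limit over all branches is a limit for `Im w → ∞` with
no condition on `Re w`. -/
theorem tendsto_im_toPuncture : Tendsto Complex.im toPuncture atTop := by
  have h1 : Tendsto (fun w => ‖nome w‖) toPuncture (𝓝[>] 0) :=
    tendsto_norm_nhdsNE_zero.comp tendsto_comap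
  have h2 := (Real.tendsto_log_nhdsGT_zero.comp h1).const_mul_atBot_of_neg
    (r := -(2 * Real.pi)⁻¹) (by have := Real.pi_pos; rw [neg_lt_zero]; positivity)
  refine h2.congr fun w => ?_
  simp only [Function.comp_apply, log_norm_nome]
  have := Real.pi_ne_zero
  field_simp

theorem im_div_natCast (w : ℂ) (m : ℕ) : (w / m).im = w.im / m := by
  rw [Complex.div_natCast_im]

theorem tendsto_nome_div {m : ℕ} (hm : 0 < m) :
    Tendsto (fun w : ℂ => nome (w / m)) toPuncture (𝓝 0) := by
  rw [tendsto_zero_iff_norm_tendsto_zero]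
  simp_rw [norm_nome, im_div_natCast]
  refine Real.tendsto_exp_atBot.comp (tendsto_neg_atTop_atBot.comp ?_)
  exact (tendsto_im_toPuncture.atTop_div_const (Nat.cast_pos.mpr hm)).const_mul_atTop
    (by have := Real.pi_pos; positivity)

theorem tendsto_matrix_of_differentiableOn {ι κ : Type*} {A : ℂ → Matrix ι κ ℂ}
    (h : ∀ i j, DifferentiableOn ℂ (fun s => A s i j) (Metric.ball 0 1)) :
    Tendsto A (𝓝 0) (𝓝 (A 0)) := by
  refine tendsto_pi_nhds.mpr fun i => tendsto_pi_nhds.mpr fun j => ?_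
  exact ((h i j).continuousOn.continuousAt (Metric.ball_mem_nhds 0 one_pos)).tendsto

theorem Filter.Tendsto.map_im {W ι κ : Type*} {l : Filter W} {A : W → Matrix ι κ ℂ}
    {A₀ : Matrix ι κ ℂ} (h : Tendsto A l (𝓝 A₀)) :
    Tendsto (fun w => (A w).map Complex.im) l (𝓝 (A₀.map Complex.im)) :=
  ((Continuous.matrix_map continuous_id Complex.continuous_im).tendsto A₀).comp h

/-! ### Asymptotics of the normed theta function in normal form -/

namespace NormalForm

variable {g₁ g₂ : ℕ} {T : ℂ → Matrix (Fin g₁ ⊕ Fin g₂) (Fin g₁ ⊕ Fin g₂) ℂ}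

/-- The holomorphic part of the normal form. -/
def S (D : NormalForm T) (s : ℂ) : Matrix (Fin g₁ ⊕ Fin g₂) (Fin g₁ ⊕ Fin g₂) ℂ :=
  fromBlocks (D.S₁ s) (D.S₃ s) (D.S₃ s)ᵀ (D.S₂ s)

theorem eq_fromBlocks_div (D : NormalForm T) {w : ℂ} (hw : 0 < w.im) :
    T w = fromBlocks (D.S₁ (nome (w / D.m))) (D.S₃ (nome (w / D.m))) (D.S₃ (nome (w / D.m)))ᵀ
      (w • D.B.map (fun r => (r : ℂ)) + D.S₂ (nome (w / D.m))) := by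
  have hm : (D.m : ℂ) ≠ 0 := Nat.cast_ne_zero.mpr D.m_pos.ne'
  have h := D.eq_fromBlocks (w / D.m) (by
    rw [im_div_natCast]; exact div_pos hw (Nat.cast_pos.mpr D.m_pos))
  rw [mul_div_cancel₀ _ hm] at h
  rw [h]
  congr 3

theorem map_im_eq (D : NormalForm T) {w : ℂ} (hw : 0 < w.im) :
    (T w).map Complex.im = fromBlocks ((D.S₁ (nome (w / D.m))).map Complex.im)
      ((D.S₃ (nome (w / D.m))).map Complex.im) ((D.S₃ (nome (w / D.m)))ᵀ.map Complex.im)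
      (w.im • D.B + (D.S₂ (nome (w / D.m))).map Complex.im) := by
  rw [D.eq_fromBlocks_div hw, fromBlocks_map]
  congr 1
  ext i j
  simp [B, Complex.mul_im]

theorem posDef_B (D : NormalForm T) : D.B.PosDef := D.posDef

theorem tendsto_S (D : NormalForm T) : Tendsto D.S (𝓝 0) (𝓝 (D.S 0)) := by
  have h₁ := tendsto_matrix_of_differentiableOn D.holomorphic_S₁
  have h₂ := tendsto_matrix_of_differentiableOn D.holomorphic_S₂
  have h₃ := tendsto_matrix_of_differentiableOn D.holomorphic_S₃
  have hc : Continuous fun p : Matrix (Fin g₁) (Fin g₁) ℂ × Matrix (Fin g₁) (Fin g₂) ℂ ×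
      Matrix (Fin g₂) (Fin g₂) ℂ => fromBlocks p.1 p.2.1 p.2.1ᵀ p.2.2 :=
    Continuous.matrix_fromBlocks (by fun_prop) (by fun_prop)
      (Continuous.matrix_transpose (by fun_prop)) (by fun_prop)
  exact (hc.tendsto (D.S₁ 0, D.S₃ 0, D.S₂ 0)).comp (h₁.prodMk_nhds (h₃.prodMk_nhds h₂))

theorem posDef_S_zero (D : NormalForm T) : ((D.S 0).map Complex.im).toBlocks₁₁.PosDef :=
  (D.mem_siegel 0 (Metric.mem_ball_self one_pos)).2

/-- The normal form does not demand that `S₂` be symmetric. It inherits symmetry from `T` and `B`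
away from the origin, and continuity carries this to the origin. -/
theorem isSymm_S_zero (D : NormalForm T) (hT : ∀ w : ℂ, 0 < w.im → (T w).IsSymm) :
    (D.S 0).IsSymm := by
  have h₂ := tendsto_matrix_of_differentiableOn D.holomorphic_S₂
  have hev : ∀ᶠ s in 𝓝[≠] (0 : ℂ), (D.S₂ s)ᵀ = D.S₂ s := by
    filter_upwards [self_mem_nhdsWithin,
      nhdsWithin_le_nhds (Metric.ball_mem_nhds (0 : ℂ) one_pos)] with s hs hs'
    obtain ⟨w, hw, rfl⟩ := exists_nome_eq hs hs'
    have hm : 0 < (D.m * w).im := by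
      simpa using mul_pos (Nat.cast_pos.mpr D.m_pos) hw
    have h := hT _ hm
    rw [D.eq_fromBlocks w hw, isSymm_fromBlocks_iff] at h
    have h4 := h.2.2.2
    have hB : (D.ratB.map fun q : ℚ => (q : ℂ))ᵀ = D.ratB.map fun q : ℚ => (q : ℂ) := by
      ext i j
      have := congrFun (congrFun D.posDef.isHermitian i) j
      simp only [conjTranspose_apply, map_apply, star_trivial, Rat.cast_inj] at this
      simp [this]
    rw [IsSymm, transpose_add, transpose_smul, hB] at h4
    exact add_left_cancel h4
  have hlim : (D.S₂ 0)ᵀ = D.S₂ 0 := tendsto_nhds_unique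
    (((continuous_id.matrix_transpose.tendsto (D.S₂ 0)).comp
      (h₂.mono_left nhdsWithin_le_nhds)).congr' hev) (h₂.mono_left nhdsWithin_le_nhds)
  exact IsSymm.fromBlocks (D.mem_siegel 0 (Metric.mem_ball_self one_pos)).1 rfl hlim

/-- The constant factor of the limit. -/
def limitConst (D : NormalForm T) : ℝ :=
  (((D.S₁ 0).map Complex.im).det * D.B.det) ^ (1 / 4 : ℝ)
    * (2 * Real.pi) ^ (-((g₂ : ℝ) / 4))

theorem limitConst_pos (D : NormalForm T) : 0 < D.limitConst := by
  have h₁ := (D.mem_siegel 0 (Metric.mem_ball_self one_pos)).2.det_pos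
  have h₂ := D.posDef_B.det_pos
  have := Real.pi_pos
  rw [limitConst]
  positivity

theorem tendsto_scaledTheta (D : NormalForm T) (hT : ∀ w : ℂ, 0 < w.im → T w ∈ SiegelSpace _)
    (a b : Fin g₁ ⊕ Fin g₂ → ℝ) :
    Tendsto (D.scaledTheta (fun w => (fun i => (a i : ℂ)) + T w *ᵥ fun i => (b i : ℂ))
        (QuotientAddGroup.mk (D.B *ᵥ (b ∘ Sum.inr)))) toPuncture
      (𝓝 ((D.limitConst * ‖limitTheta D.B (D.S 0) a b‖) ^ 2)) := by
  set Ψ := normPsi D.B (QuotientAddGroup.mk (D.B *ᵥ (b ∘ Sum.inr))) with hΨ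
  have hq := tendsto_nome_div D.m_pos
  have hdet := tendsto_det_div_pow (B := D.B) tendsto_im_toPuncture
    ((tendsto_matrix_of_differentiableOn D.holomorphic_S₁).comp hq).map_im
    ((tendsto_matrix_of_differentiableOn D.holomorphic_S₃).comp hq).map_im
    (((continuous_id.matrix_transpose.tendsto (D.S₃ 0)).comp
      (tendsto_matrix_of_differentiableOn D.holomorphic_S₃)).comp hq).map_im
    ((tendsto_matrix_of_differentiableOn D.holomorphic_S₂).comp hq).map_im
  have hsum := (tendsto_tsum_charTerm (z := id) tendsto_im_toPuncture (D.tendsto_S.comp hq)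
    D.posDef_S_zero D.posDef_B a b).norm
  have hmain := (((hdet.rpow_const (p := 1 / 4) (Or.inr (by norm_num))).mul_const
    ((2 * Real.pi) ^ (-((g₂ : ℝ) / 4)))).mul hsum).pow 2
  refine hmain.congr' ?_
  filter_upwards [tendsto_im_toPuncture.eventually_gt_atTop 0] with w hw
  have hπ := Real.pi_pos
  have hexp := exp_mul_norm_tsum_charTerm (D.S₁ (nome (w / D.m))) (D.S₃ (nome (w / D.m)))
    (D.S₃ (nome (w / D.m)))ᵀ (D.S₂ (nome (w / D.m))) D.B w a b (2 * Ψ)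
  rw [← D.eq_fromBlocks_div hw] at hexp
  have hpsi : ‖nome w‖ ^ (-Ψ) = Real.exp (Real.pi * (w.im * (2 * Ψ))) := by
    rw [norm_nome, ← Real.exp_mul]
    congr 1
    ring
  -- The power of `-log |t| = 2π Im w` splits: `Im w` normalizes the determinant, while `2π` goes
  -- into `limitConst`.
  have hpow : ((T w).map Complex.im).det ^ (1 / 4 : ℝ) * (w.im) ^ (-((g₂ : ℝ) / 4))
      = (((T w).map Complex.im).det / w.im ^ g₂) ^ (1 / 4 : ℝ) := by
    rw [Real.div_rpow (hT w hw).2.det_pos.le (by positivity), ← Real.rpow_natCast w.im,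
      ← Real.rpow_mul hw.le, Real.rpow_neg hw.le, div_eq_mul_inv]
    congr 3
    ring
  rw [scaledTheta, normTheta_add_mulVec (hT w hw), ← hΨ, hpsi, log_norm_nome, neg_neg,
    Real.mul_rpow (by positivity) hw.le]
  rw [D.map_im_eq hw] at hpow ⊢
  simp only [Function.comp_apply, id, Fintype.card_fin]
  rw [← hpow]
  simp only [S] at hexp ⊢
  rw [← hexp]
  ring

/-- The last coordinates have imaginary part `Im w · B b₂` plus a convergent remainder, and the
defining quotient divides by `Im w`. -/
theorem hasTrop_add_mulVec (D : NormalForm T) (a b : Fin g₁ ⊕ Fin g₂ → ℝ) :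
    D.HasTrop (fun w => (fun i => (a i : ℂ)) + T w *ᵥ fun i => (b i : ℂ))
      (QuotientAddGroup.mk (D.B *ᵥ (b ∘ Sum.inr))) := by
  refine ⟨D.B *ᵥ (b ∘ Sum.inr), ?_, rfl⟩
  have hq := tendsto_nome_div D.m_pos
  have hinv : Tendsto (fun w : ℂ => w.im⁻¹) toPuncture (𝓝 0) :=
    tendsto_inv_atTop_zero.comp tendsto_im_toPuncture
  have h₃ := (((continuous_id.matrix_transpose.tendsto (D.S₃ 0)).comp
      (tendsto_matrix_of_differentiableOn D.holomorphic_S₃)).comp hq).map_im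
  have h₂ := ((tendsto_matrix_of_differentiableOn D.holomorphic_S₂).comp hq).map_im
  have hrest : Tendsto (fun w : ℂ => ((D.S₃ (nome (w / D.m)))ᵀ.map Complex.im) *ᵥ (b ∘ Sum.inl)
      + (D.S₂ (nome (w / D.m))).map Complex.im *ᵥ (b ∘ Sum.inr)) toPuncture
      (𝓝 ((D.S₃ 0)ᵀ.map Complex.im *ᵥ (b ∘ Sum.inl)
        + (D.S₂ 0).map Complex.im *ᵥ (b ∘ Sum.inr))) := by
    refine Tendsto.add ?_ ?_
    · exact ((Continuous.matrix_mulVec continuous_id continuous_const).tendsto _).comp h₃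
    · exact ((Continuous.matrix_mulVec continuous_id continuous_const).tendsto _).comp h₂
  have hlim := (hinv.smul hrest).const_add (D.B *ᵥ (b ∘ Sum.inr))
  rw [zero_smul, add_zero] at hlim
  refine hlim.congr' ?_
  filter_upwards [tendsto_im_toPuncture.eventually_gt_atTop 0] with w hw
  ext j
  have him : (((fun i => (a i : ℂ)) + T w *ᵥ fun i => (b i : ℂ)) (Sum.inr j)).im
      = ((T w).map Complex.im *ᵥ b) (Sum.inr j) := by
    simp [im_mulVec_ofReal]
  rw [him, log_norm_nome, D.map_im_eq hw, fromBlocks_mulVec, Sum.elim_inr, add_mulVec,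
    smul_mulVec]
  simp only [Pi.add_apply, Pi.smul_apply, smul_eq_mul]
  have := Real.pi_ne_zero
  field_simp
  ring

end NormalForm

/-! ### Monodromy and rationality of flat sections -/

theorem nome_add_natCast (w : ℂ) (k : ℕ) : nome (w + k) = nome w := by
  rw [nome, nome, mul_add, Complex.exp_add, mul_comm (2 * (Real.pi : ℂ) * Complex.I) (k : ℂ),
    Complex.exp_nat_mul_two_pi_mul_I, mul_one]

theorem exists_pos_mul_sq_norm_le_re_hermForm {ι : Type} [Fintype ι] {H : Matrix ι ι ℂ}
    (hH : H.PosDef) :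
    ∃ c > 0, ∀ x : ι → ℂ, c * ‖x‖ ^ 2 ≤ (hermForm H x x).re := by
  refine exists_pos_mul_sq_norm_le (fun x : ι → ℂ => (hermForm H x x).re) ?_ ?_ ?_
  · unfold hermForm
    fun_prop
  · intro r x
    have : star (r • x) = (r : ℂ) • star x := by ext i; simp
    have h2 : r • x = (r : ℂ) • x := by ext i; simp
    simp only [hermForm]
    rw [this, h2, mulVec_smul, dotProduct_smul, smul_dotProduct, smul_smul, smul_eq_mul,
      ← sq, ← Complex.ofReal_pow, Complex.re_ofReal_mul]
  · intro x hx
    -- `hermForm` conjugates its second argument, whereas positive definiteness is phrased with the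
    -- first one conjugated.
    have h := hH.dotProduct_mulVec_pos (x := star x) (by simpa using hx)
    rw [star_star] at h
    exact (Complex.pos_iff.mp h).1

section Lattice

variable {ι : Type} [Fintype ι] [DecidableEq ι] {L : AddSubgroup (ι → ℂ)} {H : Matrix ι ι ℂ}

theorem hermForm_mulVec_left (H f : Matrix ι ι ℂ) (v y : ι → ℂ) :
    hermForm H (f *ᵥ v) y = ∑ k, v k * hermForm H (f *ᵥ Pi.single k 1) y := by
  have h : ∀ v, hermForm H (f *ᵥ v) y = v ⬝ᵥ (fᵀ *ᵥ (H *ᵥ star y)) := by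
    intro v
    rw [hermForm, dotProduct_mulVec v, vecMul_transpose]
  simp_rw [h, single_one_dotProduct]
  rfl

/-- Riemann's relation: in a frame given by half of a symplectic basis, the polarization is the
inverse of the imaginary part of the period matrix. -/
theorem IsSymplecticBasis.re_hermForm_eq {f T : Matrix ι ι ℂ}
    (h : IsSymplecticBasis L H (fun j => f *ᵥ Pi.single j 1) fun j => f *ᵥ (T *ᵥ Pi.single j 1))
    (i j : ι) : (hermForm H (f *ᵥ Pi.single i 1) (f *ᵥ Pi.single j 1)).re
      = ((T.map Complex.im)ᵀ)⁻¹ i j := by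
  let G : Matrix ι ι ℝ := of fun i j =>
    (hermForm H (f *ᵥ Pi.single i 1) (f *ᵥ Pi.single j 1)).re
  -- The `i`-th period vector is expanded in the frame vectors. Among these the form is real, so
  -- only `Im T` contributes to the imaginary part.
  have hG : (T.map Complex.im)ᵀ * G = 1 := by
    ext i j
    have h1 := h.form_mixed i j
    rw [hermForm_mulVec_left, Complex.im_sum] at h1
    rw [mul_apply, one_apply, ← h1]
    refine Finset.sum_congr rfl fun k _ => ?_
    rw [Complex.mul_im, h.form_left k j]
    simp [G]
  rw [inv_eq_right_inv hG]
  rfl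

theorem IsSymplecticBasis.exists_int_coords {f T : Matrix ι ι ℂ}
    (h : IsSymplecticBasis L H (fun j => f *ᵥ Pi.single j 1) fun j => f *ᵥ (T *ᵥ Pi.single j 1))
    {x : ι → ℂ} (hx : x ∈ L) :
    ∃ p q : ι → ℤ, x = f *ᵥ ((fun i => (p i : ℂ)) + T *ᵥ fun i => (q i : ℂ)) := by
  have hcast : ∀ j, (fun i => (((Pi.single j 1 : ι → ℤ) i : ℤ) : ℂ)) = Pi.single j 1 := by
    intro j
    ext i
    by_cases hij : i = j
    · subst hij; simp
    · simp [hij]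
  rw [← h.closure_eq] at hx
  induction hx using AddSubgroup.closure_induction with
  | mem x hx =>
    obtain ⟨j | j, rfl⟩ := hx
    · exact ⟨Pi.single j 1, 0, by rw [hcast]; simp [← Pi.zero_def]⟩
    · exact ⟨0, Pi.single j 1, by rw [hcast]; simp [← Pi.zero_def]⟩
  | zero => exact ⟨0, 0, by simp [← Pi.zero_def]⟩
  | add x y _ _ hx hy =>
    obtain ⟨p, q, rfl⟩ := hx
    obtain ⟨p', q', rfl⟩ := hy
    refine ⟨p + p', q + q', ?_⟩
    have e : ∀ r r' : ι → ℤ, (fun i => (((r + r') i : ℤ) : ℂ))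
        = (fun i => (r i : ℂ)) + fun i => (r' i : ℂ) := fun r r' => by ext i; simp
    rw [e, e, ← mulVec_add, mulVec_add T]
    congr 1
    abel
  | neg x _ hx =>
    obtain ⟨p, q, rfl⟩ := hx
    refine ⟨-p, -q, ?_⟩
    have e : ∀ r : ι → ℤ, (fun i => (((-r) i : ℤ) : ℂ)) = -fun i => (r i : ℂ) :=
      fun r => by ext i; simp
    rw [e, e, ← mulVec_neg, mulVec_neg (A := T), neg_add]

/-- A polarized lattice has only finitely many vectors of bounded length. -/
theorem IsSymplecticBasis.finite_re_hermForm_le {l μ : ι → ι → ℂ}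
    (h : IsSymplecticBasis L H l μ) (hH : H.PosDef) (C : ℝ) :
    {x | x ∈ L ∧ (hermForm H x x).re ≤ C}.Finite := by
  have hcard : Fintype.card (ι ⊕ ι) = Module.finrank ℝ (ι → ℂ) := by
    rw [Fintype.card_sum, Module.finrank_pi_fintype]
    simp [Complex.finrank_real_complex, mul_two]
  obtain ⟨c, hc, hle⟩ := exists_pos_mul_sq_norm_le_re_hermForm hH
  have hspan : ∃ b : Module.Basis (ι ⊕ ι) ℝ (ι → ℂ), ⇑b = Sum.elim l μ := by
    rcases isEmpty_or_nonempty ι with hι | hι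
    · exact ⟨Module.Basis.empty _, Subsingleton.elim _ _⟩
    · exact ⟨basisOfLinearIndependentOfCardEqFinrank h.linearIndependent hcard, by simp⟩
  obtain ⟨b, hb⟩ := hspan
  refine (ZSpan.setFinite_inter b (s := {x | ‖x‖ ^ 2 ≤ C / c}) ?_).subset ?_
  · refine (Metric.isBounded_closedBall (x := (0 : ι → ℂ)) (r := Real.sqrt (C / c))).subset ?_
    intro x hx
    rw [mem_closedBall_zero_iff]
    exact Real.le_sqrt_of_sq_le hx
  · rintro x ⟨hx, hxC⟩
    refine ⟨?_, ?_⟩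
    · rw [Set.mem_ofPred_eq, le_div_iff₀ hc]
      linarith [hle x]
    · rw [← h.closure_eq, ← hb] at hx
      rw [SetLike.mem_coe, ← Submodule.mem_toAddSubgroup,
        Submodule.span_int_eq_addSubgroupClosure]
      exact hx

end Lattice

theorem exists_natCast_mul_inv_eq_intCast {κ : Type*} [Fintype κ] [DecidableEq κ]
    (A : Matrix κ κ ℚ) : ∃ d : ℕ, 0 < d ∧ ∀ i j, ∃ e : ℤ, (d : ℚ) * A i j = e := by
  refine ⟨∏ p : κ × κ, (A p.1 p.2).den, Finset.prod_pos fun p _ => (A p.1 p.2).pos,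
    fun i j => ?_⟩
  obtain ⟨r, hr⟩ := Finset.dvd_prod_of_mem (fun p : κ × κ => (A p.1 p.2).den)
    (Finset.mem_univ (i, j))
  refine ⟨r * (A i j).num, ?_⟩
  rw [hr]
  push_cast
  rw [mul_comm ((A i j).den : ℚ), mul_assoc, mul_comm ((A i j).den : ℚ), Rat.mul_den_eq_num]

/-- `d` is a common denominator of `A⁻¹`, which is why it serves for all `r`, `x` and `p`. -/
theorem exists_int_of_mulVec_int {κ : Type*} [Fintype κ] [DecidableEq κ] {A : Matrix κ κ ℚ}
    (hA : (A.map fun q : ℚ => (q : ℝ)).PosDef) :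
    ∃ d : ℕ, 0 < d ∧ ∀ (r : ℝ) (x : κ → ℝ) (p : κ → ℤ),
      (∀ i, r * ((A.map fun q : ℚ => (q : ℝ)) *ᵥ x) i = p i) →
      ∀ j, ∃ e : ℤ, d * r * x j = e := by
  obtain ⟨d, hd, he⟩ := exists_natCast_mul_inv_eq_intCast A⁻¹
  choose e he using he
  have hdet : A.det ≠ 0 := by
    intro h0
    have h1 := hA.det_pos
    have h2 : (A.map fun q : ℚ => (q : ℝ)).det = ((A.det : ℚ) : ℝ) :=
      ((Rat.castHom ℝ).map_det A).symm
    rw [h2, h0] at h1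
    simp at h1
  have hinv : (A⁻¹.map fun q : ℚ => (q : ℝ)) * (A.map fun q : ℚ => (q : ℝ)) = 1 := by
    have h1 : A⁻¹ * A = 1 := nonsing_inv_mul A (isUnit_iff_ne_zero.mpr hdet)
    have h2 := congrArg (fun M : Matrix κ κ ℚ => M.map (Rat.castHom ℝ)) h1
    simp only [Matrix.map_mul] at h2
    refine h2.trans ?_
    simp
  refine ⟨d, hd, fun r x p hp j => ⟨∑ i, e j i * p i, ?_⟩⟩
  have hx : x = (A⁻¹.map fun q : ℚ => (q : ℝ)) *ᵥ ((A.map fun q : ℚ => (q : ℝ)) *ᵥ x) := by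
    rw [mulVec_mulVec, hinv, one_mulVec]
  have hej : ∀ i, (e j i : ℝ) = d * (A⁻¹ j i : ℝ) := fun i => by
    exact_mod_cast (he j i).symm
  conv_lhs => rw [hx]
  push_cast
  rw [mulVec, dotProduct, Finset.mul_sum]
  refine Finset.sum_congr rfl fun i _ => ?_
  rw [hej, ← hp, map_apply]
  ring

namespace NormalForm

variable {g₁ g₂ : ℕ}

theorem apply_mul_add_natCast {T : ℂ → Matrix (Fin g₁ ⊕ Fin g₂) (Fin g₁ ⊕ Fin g₂) ℂ}
    (D : NormalForm T) {w : ℂ} (hw : 0 < w.im) (k : ℕ) :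
    T (D.m * (w + k)) = T (D.m * w)
      + fromBlocks 0 0 0 ((D.m * k : ℂ) • D.ratB.map fun q : ℚ => (q : ℂ)) := by
  rw [D.eq_fromBlocks (w + k) (by simpa using hw), D.eq_fromBlocks w hw, nome_add_natCast,
    fromBlocks_add]
  simp only [add_zero]
  congr 1
  rw [mul_add, add_smul]
  abel

/-- The frames of the period map take the same value over two of the points lying over a point of
the punctured disc: they send the standard basis to lattice vectors of the same length. -/
theorem exists_frame_eq {F : PPAVFamily (Fin g₁ ⊕ Fin g₂)} {P : F.PeriodMap} (D : NormalForm P.T)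
    {w : ℂ} (hw : 0 < w.im) :
    ∃ k l : ℕ, k < l ∧ P.frame (D.m * (w + k)) = P.frame (D.m * (w + l)) := by
  have hw' : ∀ k : ℕ, 0 < (D.m * (w + k) : ℂ).im := fun k => by
    simpa using mul_pos (Nat.cast_pos.mpr D.m_pos) hw
  have hpt : ∀ k, nomePt _ (hw' k) = nomePt _ (hw' 0) := by
    intro k
    refine Subtype.ext ?_
    have h1 := nome_add_natCast (D.m * w) (D.m * k)
    simp only [nomePt, Nat.cast_zero, add_zero, ← h1]
    congr 1
    push_cast
    ring
  -- Monodromy adds a real matrix to `T`, so by Riemann's relation the lengths of the frame vectors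
  -- do not change.
  have hIm : ∀ k : ℕ, (P.T (D.m * (w + k))).map Complex.im = (P.T (D.m * w)).map Complex.im := by
    intro k
    rw [D.apply_mul_add_natCast hw]
    ext i j
    rcases i with i | i <;> rcases j with j | j <;> simp
  set Y := ((P.T (D.m * w)).map Complex.im) with hY
  set t := nomePt _ (hw' 0)
  have hbasis : ∀ k : ℕ, IsSymplecticBasis (F.lattice t) (F.herm t)
      (fun j => P.frame (D.m * (w + k)) *ᵥ Pi.single j 1)
      (fun j => P.frame (D.m * (w + k)) *ᵥ (P.T (D.m * (w + k)) *ᵥ Pi.single j 1)) := by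
    intro k
    have h := P.isSymplecticBasis _ (hw' k)
    rwa [hpt] at h
  have hfin : {v : Fin g₁ ⊕ Fin g₂ → Fin g₁ ⊕ Fin g₂ → ℂ | ∀ j, v j ∈ {x | x ∈ F.lattice t ∧
      (hermForm (F.herm t) x x).re ≤ (Yᵀ)⁻¹ j j}}.Finite :=
    Set.Finite.pi' fun j => (hbasis 0).finite_re_hermForm_le (F.herm_posDef t) _
  have hmem : ∀ k : ℕ, (fun j => P.frame (D.m * (w + k)) *ᵥ Pi.single j 1)
      ∈ {v : Fin g₁ ⊕ Fin g₂ → Fin g₁ ⊕ Fin g₂ → ℂ | ∀ j, v j ∈ {x | x ∈ F.lattice t ∧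
        (hermForm (F.herm t) x x).re ≤ (Yᵀ)⁻¹ j j}} := by
    intro k j
    refine ⟨?_, ?_⟩
    · rw [← (hbasis k).closure_eq]
      exact AddSubgroup.subset_closure ⟨Sum.inl j, rfl⟩
    · rw [(hbasis k).re_hermForm_eq, hIm]
  -- Pigeonhole: infinitely many branches, finitely many tuples of short lattice vectors.
  obtain ⟨k, l, hkl, h⟩ := Set.Finite.exists_lt_map_eq_of_forall_mem hmem hfin
  refine ⟨k, l, hkl, ?_⟩
  ext i j
  have h1 := congrFun (congrFun h j) i
  simpa using h1

end NormalForm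

namespace NormalForm

variable {g₁ g₂ : ℕ} {F : PPAVFamily (Fin g₁ ⊕ Fin g₂)} {P : F.PeriodMap}

theorem sub_mem_lattice_of_mk_eq {z : (t : PuncturedDisc) → F.fiber t} {t t' : PuncturedDisc}
    (h : t = t') {u u' : Fin g₁ ⊕ Fin g₂ → ℂ} (hu : z t = QuotientAddGroup.mk u)
    (hu' : z t' = QuotientAddGroup.mk u') : u' - u ∈ F.lattice t' := by
  subst h
  rw [hu, QuotientAddGroup.eq] at hu'
  rwa [sub_eq_neg_add]

/-- If the flat multi-valued map with real coordinates `a`, `b` is a single-valued section, then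
the last coordinates of `b` are rational with bounded denominators. -/
theorem exists_denominator (D : NormalForm P.T) :
    ∃ N : ℕ, 0 < N ∧ ∀ (z : (t : PuncturedDisc) → F.fiber t) (a b : Fin g₁ ⊕ Fin g₂ → ℝ),
      P.IsLift z (P.flatMap a b) → ∀ j, ∃ e : ℤ, N * b (Sum.inr j) = e := by
  have hw : 0 < Complex.I.im := by simp
  -- The branches are compared over one fixed point, before any section is given, so the denominator
  -- is uniform.
  obtain ⟨k, l, hkl, hframe⟩ := D.exists_frame_eq hw
  obtain ⟨d, hd, hint⟩ := exists_int_of_mulVec_int D.posDef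
  refine ⟨d * (D.m * (l - k)), Nat.mul_pos hd (Nat.mul_pos D.m_pos (Nat.sub_pos_of_lt hkl)),
    fun z a b hz j => ?_⟩
  have hw' : ∀ k : ℕ, 0 < (D.m * (Complex.I + k) : ℂ).im := fun k => by
    simpa using D.m_pos
  have hpt : nomePt _ (hw' k) = nomePt _ (hw' l) := by
    refine Subtype.ext ?_
    have h1 : ∀ k : ℕ, nome (D.m * (Complex.I + k)) = nome (D.m * Complex.I) := by
      intro k
      rw [← nome_add_natCast (D.m * Complex.I) (D.m * k)]
      congr 1
      push_cast
      ring
    simp only [nomePt, h1]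
  have hmem := sub_mem_lattice_of_mk_eq hpt (hz _ (hw' k)) (hz _ (hw' l))
  obtain ⟨p, q, hpq⟩ := (P.isSymplecticBasis _ (hw' l)).exists_int_coords hmem
  rw [hframe, ← mulVec_sub] at hpq
  have hinj := mulVec_injective_of_isUnit (P.isUnit_frame _ (hw' l)) hpq
  set x : Fin g₂ → ℝ := b ∘ Sum.inr with hx
  set r : ℝ := D.m * (l - k) with hr
  have hsub : ∀ X X' : Matrix (Fin g₂) (Fin g₂) ℂ,
      (fromBlocks 0 0 0 X - fromBlocks 0 0 0 X' : Matrix (Fin g₁ ⊕ Fin g₂) (Fin g₁ ⊕ Fin g₂) ℂ)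
        = fromBlocks 0 0 0 (X - X') := by
    intro X X'
    ext (i | i) (j | j) <;> simp
  have hdiff : P.flatMap a b (D.m * (Complex.I + l)) - P.flatMap a b (D.m * (Complex.I + k))
      = fun i => ((Sum.elim 0 (r • (D.B *ᵥ x)) : Fin g₁ ⊕ Fin g₂ → ℝ) i : ℂ) := by
    rw [PPAVFamily.PeriodMap.flatMap, PPAVFamily.PeriodMap.flatMap, add_sub_add_left_eq_sub,
      ← sub_mulVec, D.apply_mul_add_natCast hw, D.apply_mul_add_natCast hw,
      add_sub_add_left_eq_sub, hsub, fromBlocks_mulVec]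
    ext (i | i)
    · simp
    · simp only [zero_mulVec, zero_add, Sum.elim_inr, ← sub_smul, smul_mulVec,
        Pi.smul_apply, smul_eq_mul, hr]
      rw [mulVec, mulVec, dotProduct, dotProduct]
      push_cast
      rw [mul_sub]
      congr 1
  rw [hdiff] at hinj
  have hIm := (P.mem_siegel _ (hw' l)).2
  -- The difference of the two branches is a real vector, so its component along the columns of `T`
  -- vanishes because `Im T` is invertible. Hence `r B x` is integral.
  have hq0 : (fun i => (q i : ℝ)) = 0 := by
    have h1 : ((P.T (D.m * (Complex.I + l))).map Complex.im) *ᵥ (fun i => (q i : ℝ)) = 0 := by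
      ext i
      have h2 := congrArg Complex.im (congrFun hinj i)
      have h3 := im_mulVec_ofReal (P.T (D.m * (Complex.I + l))) (fun i => (q i : ℝ)) i
      simp only [Complex.ofReal_intCast] at h3
      simp only [Complex.ofReal_im, Pi.add_apply, Complex.add_im, Complex.intCast_im, zero_add,
        h3] at h2
      exact h2.symm
    exact mulVec_injective_of_isUnit hIm.isUnit (h1.trans (mulVec_zero _).symm)
  have hq1 : (fun i => (q i : ℂ)) = 0 := by
    ext i
    have := congrFun hq0 i
    simp only [Pi.zero_apply, Int.cast_eq_zero] at this ⊢
    exact this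
  rw [hq1, mulVec_zero, add_zero] at hinj
  obtain ⟨e, he⟩ := hint r x (p ∘ Sum.inr) (fun i => by
    have h1 := congrFun hinj (Sum.inr i)
    simp only [Sum.elim_inr, Pi.smul_apply, smul_eq_mul] at h1
    exact_mod_cast h1) j
  refine ⟨e, ?_⟩
  rw [← he, hr]
  push_cast [Nat.cast_sub hkl.le]
  simp [hx, mul_assoc]

end NormalForm

/-! ### Interpolation between the limit functions -/

/-- The normalized Fejér kernel `|N⁻¹ ∑_{k < N} exp(2 π i k x)|²`, which interpolates the
characteristic function of `ℤ` on `N⁻¹ ℤ`. -/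
def fejerWeight (N : ℕ) (x : ℝ) : ℝ :=
  ‖(N : ℂ)⁻¹ * ∑ k ∈ Finset.range N, Complex.exp (2 * Real.pi * Complex.I * x) ^ k‖ ^ 2

theorem fejerWeight_nonneg (N : ℕ) (x : ℝ) : 0 ≤ fejerWeight N x := sq_nonneg _

theorem fejerWeight_intCast {N : ℕ} (hN : 0 < N) (n : ℤ) : fejerWeight N n = 1 := by
  have h : Complex.exp (2 * Real.pi * Complex.I * ((n : ℝ) : ℂ)) = 1 := by
    rw [Complex.exp_eq_one_iff]
    exact ⟨n, by push_cast; ring⟩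
  have hN' : (N : ℂ) ≠ 0 := Nat.cast_ne_zero.mpr hN.ne'
  rw [fejerWeight, h]
  simp [hN']

theorem fejerWeight_div_eq_zero {N : ℕ} (hN : 0 < N) {n : ℤ} (hn : ¬ (N : ℤ) ∣ n) :
    fejerWeight N (n / N) = 0 := by
  have hN' : (N : ℂ) ≠ 0 := Nat.cast_ne_zero.mpr hN.ne'
  set ζ := Complex.exp (2 * Real.pi * Complex.I * ((n / N : ℝ) : ℂ)) with hζ
  have h1 : ζ ≠ 1 := by
    intro h
    rw [hζ, Complex.exp_eq_one_iff] at h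
    obtain ⟨e, he⟩ := h
    rw [mul_comm (e : ℂ)] at he
    have h2 := mul_left_cancel₀ Complex.two_pi_I_ne_zero he
    push_cast at h2
    rw [div_eq_iff hN'] at h2
    exact hn ⟨e, by rw [mul_comm]; exact_mod_cast h2⟩
  have hpow : ζ ^ N = 1 := by
    rw [hζ, ← Complex.exp_nat_mul, Complex.exp_eq_one_iff]
    refine ⟨n, ?_⟩
    push_cast
    field_simp
  have hsum : ∑ k ∈ Finset.range N, ζ ^ k = 0 := by
    have h2 := geom_sum_mul ζ N
    rw [hpow, sub_self] at h2
    exact (mul_eq_zero.mp h2).resolve_right (sub_ne_zero.mpr h1)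
  rw [fejerWeight, ← hζ, hsum]
  simp

/-- The square is what makes the modulus analytic across zeros of `f`: it equals `re² + im²`. -/
theorem AnalyticAt.sq_norm {E : Type*} [NormedAddCommGroup E] [NormedSpace ℝ E] {f : E → ℂ}
    {x : E} (hf : AnalyticAt ℝ f x) : AnalyticAt ℝ (fun y => ‖f y‖ ^ 2) x := by
  have h : (fun y => ‖f y‖ ^ 2) = fun y => (f y).re ^ 2 + (f y).im ^ 2 := by
    ext y
    rw [← Complex.normSq_eq_norm_sq, Complex.normSq_apply]
    ring
  rw [h]
  exact (((Complex.reCLM.analyticAt _).comp hf).pow 2).add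
    (((Complex.imCLM.analyticAt _).comp hf).pow 2)

theorem analyticAt_fejerWeight (N : ℕ) (x : ℝ) : AnalyticAt ℝ (fejerWeight N) x := by
  refine AnalyticAt.sq_norm (analyticAt_const.mul (Finset.analyticAt_fun_sum _ fun k _ => ?_))
  have h : AnalyticAt ℝ (fun y : ℝ => 2 * Real.pi * Complex.I * (y : ℂ)) x :=
    analyticAt_const.mul (Complex.ofRealCLM.analyticAt x)
  exact ((analyticAt_cexp (z := 2 * Real.pi * Complex.I * x)).restrictScalars.comp_of_eq h
    rfl).pow k

namespace NormalForm

variable {g₁ g₂ : ℕ} {T : ℂ → Matrix (Fin g₁ ⊕ Fin g₂) (Fin g₁ ⊕ Fin g₂) ℂ}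

/-- The limit of the rescaled theta function for real coordinates `a`, `b`, with the last
coordinates of `b` replaced by `c`. -/
def limitFunction (D : NormalForm T) (c : Fin g₂ → ℝ)
    (p : (Fin g₁ ⊕ Fin g₂ → ℝ) × (Fin g₁ ⊕ Fin g₂ → ℝ)) : ℝ :=
  (D.limitConst * ‖limitTheta D.B (D.S 0) p.1 (Sum.elim (p.2 ∘ Sum.inl) c)‖) ^ 2

theorem limitFunction_nonneg (D : NormalForm T) (c : Fin g₂ → ℝ)
    (p : (Fin g₁ ⊕ Fin g₂ → ℝ) × (Fin g₁ ⊕ Fin g₂ → ℝ)) : 0 ≤ D.limitFunction c p := sq_nonneg _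

theorem analyticAt_limitFunction (D : NormalForm T) (hT : ∀ w : ℂ, 0 < w.im → (T w).IsSymm)
    (c : Fin g₂ → ℝ) (p : (Fin g₁ ⊕ Fin g₂ → ℝ) × (Fin g₁ ⊕ Fin g₂ → ℝ)) :
    AnalyticAt ℝ (D.limitFunction c) p := by
  have h : D.limitFunction c = fun p => D.limitConst ^ 2
      * ‖limitTheta D.B (D.S 0) p.1 (Sum.elim (p.2 ∘ Sum.inl) c)‖ ^ 2 := by
    ext p; rw [limitFunction, mul_pow]
  rw [h]
  exact analyticAt_const.mul
    (analyticAt_limitTheta (D.isSymm_S_zero hT) D.posDef_S_zero D.posDef_B c p).sq_norm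

theorem exists_limitFunction_ne_zero (D : NormalForm T) (c : Fin g₂ → ℝ) :
    ∃ a b : Fin g₁ ⊕ Fin g₂ → ℝ, b ∘ Sum.inr = c ∧ D.limitFunction c (a, b) ≠ 0 := by
  obtain ⟨a, ha⟩ := exists_limitTheta_ne_zero D.posDef_S_zero D.posDef_B
    (Sum.elim 0 c : Fin g₁ ⊕ Fin g₂ → ℝ)
  refine ⟨a, Sum.elim 0 c, by simp, ?_⟩
  simp only [limitFunction, Sum.elim_comp_inl]
  exact pow_ne_zero 2 (mul_ne_zero D.limitConst_pos.ne' (norm_ne_zero_iff.mpr ha))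

/-- Leaves only the residues modulo `N` to interpolate when `c` has denominator `N`. -/
theorem limitFunction_add_int (D : NormalForm T) (c : Fin g₂ → ℝ) (k : Fin g₂ → ℤ)
    (p : (Fin g₁ ⊕ Fin g₂ → ℝ) × (Fin g₁ ⊕ Fin g₂ → ℝ)) :
    D.limitFunction (intShift k c) p = D.limitFunction c p := by
  have h := norm_limitTheta_add_int D.B (D.S 0) p.1 (Sum.elim (p.2 ∘ Sum.inl) c) (Sum.elim 0 k)
  have h2 : intShift (Sum.elim 0 k) (Sum.elim (p.2 ∘ Sum.inl) c)
      = Sum.elim (p.2 ∘ Sum.inl) (intShift k c) := by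
    ext (i | i) <;> simp [intShift]
  rw [h2] at h
  rw [limitFunction, limitFunction, h]

theorem tendsto_scaledTheta_limitFunction (D : NormalForm T)
    (hT : ∀ w : ℂ, 0 < w.im → T w ∈ SiegelSpace _) (a b : Fin g₁ ⊕ Fin g₂ → ℝ) :
    Tendsto (D.scaledTheta (fun w => (fun i => (a i : ℂ)) + T w *ᵥ fun i => (b i : ℂ))
        (QuotientAddGroup.mk (D.B *ᵥ (b ∘ Sum.inr)))) toPuncture
      (𝓝 (D.limitFunction (b ∘ Sum.inr) (a, b))) := by
  have h := D.tendsto_scaledTheta hT a b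
  rwa [limitFunction, Sum.elim_comp_inl_inr]

/-- An analytic function which interpolates the limit functions for all `c` with denominator
`N`. -/
def interpolatedLimit (D : NormalForm T) (N : ℕ)
    (p : (Fin g₁ ⊕ Fin g₂ → ℝ) × (Fin g₁ ⊕ Fin g₂ → ℝ)) : ℝ :=
  ∑ r : Fin g₂ → Fin N, D.limitFunction (fun j => (r j : ℝ) / N) p
    * ∏ j, fejerWeight N (p.2 (Sum.inr j) - (r j : ℝ) / N)

theorem interpolatedLimit_nonneg (D : NormalForm T) (N : ℕ)
    (p : (Fin g₁ ⊕ Fin g₂ → ℝ) × (Fin g₁ ⊕ Fin g₂ → ℝ)) : 0 ≤ D.interpolatedLimit N p :=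
  Finset.sum_nonneg fun _ _ => mul_nonneg (D.limitFunction_nonneg _ _)
    (Finset.prod_nonneg fun _ _ => fejerWeight_nonneg _ _)

theorem analyticAt_interpolatedLimit (D : NormalForm T)
    (hT : ∀ w : ℂ, 0 < w.im → (T w).IsSymm) (N : ℕ)
    (p : (Fin g₁ ⊕ Fin g₂ → ℝ) × (Fin g₁ ⊕ Fin g₂ → ℝ)) :
    AnalyticAt ℝ (D.interpolatedLimit N) p := by
  refine Finset.analyticAt_fun_sum _ fun r _ => (D.analyticAt_limitFunction hT _ p).mul
    (Finset.analyticAt_fun_prod _ fun j _ => ?_)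
  refine (analyticAt_fejerWeight N (p.2 (Sum.inr j) - (r j : ℝ) / N)).comp (f := fun p :
    (Fin g₁ ⊕ Fin g₂ → ℝ) × (Fin g₁ ⊕ Fin g₂ → ℝ) => p.2 (Sum.inr j) - (r j : ℝ) / N) ?_
  exact (((ContinuousLinearMap.proj (R := ℝ) (φ := fun _ : Fin g₁ ⊕ Fin g₂ => ℝ)
    (Sum.inr j)).comp (ContinuousLinearMap.snd ℝ _ _)).analyticAt p).sub analyticAt_const

theorem interpolatedLimit_eq (D : NormalForm T) {N : ℕ} (hN : 0 < N)
    (p : (Fin g₁ ⊕ Fin g₂ → ℝ) × (Fin g₁ ⊕ Fin g₂ → ℝ))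
    (hp : ∀ j, ∃ e : ℤ, N * p.2 (Sum.inr j) = e) :
    D.interpolatedLimit N p = D.limitFunction (p.2 ∘ Sum.inr) p := by
  choose e he using hp
  have hN' : (N : ℝ) ≠ 0 := Nat.cast_ne_zero.mpr hN.ne'
  have hNz : (N : ℤ) ≠ 0 := Nat.cast_ne_zero.mpr hN.ne'
  have hval : ∀ j, p.2 (Sum.inr j) = e j / N := fun j => by
    rw [← he, mul_div_cancel_left₀ _ hN']
  -- The residue class of `N b₂`. Its weight is 1, and for any other `r` some coordinate puts a zero
  -- of the Fejér kernel into the product.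
  let r₀ : Fin g₂ → Fin N := fun j => ⟨(e j % N).toNat, by
    have h1 := Int.emod_lt_of_pos (e j) (Int.natCast_pos.mpr hN)
    have h2 := Int.emod_nonneg (e j) hNz
    omega⟩
  have hr₀ : ∀ j, ((r₀ j : ℕ) : ℤ) = e j % N := fun j =>
    Int.toNat_of_nonneg (Int.emod_nonneg (e j) hNz)
  have hr₀' : ∀ j, ((r₀ j : ℕ) : ℝ) = ((e j % N : ℤ) : ℝ) := fun j => by
    exact_mod_cast congrArg (Int.cast : ℤ → ℝ) (hr₀ j)
  have hdiv : ∀ j, (e j : ℝ) = ((e j % N : ℤ) : ℝ) + N * ((e j / N : ℤ) : ℝ) := fun j => by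
    exact_mod_cast (Int.emod_add_mul_ediv (e j) N).symm
  have hshift : p.2 ∘ Sum.inr = intShift (fun j => e j / N) fun j => ((r₀ j : ℕ) : ℝ) / N := by
    ext j
    simp only [Function.comp_apply, intShift]
    rw [hval, hr₀', hdiv j]
    field_simp
    ring
  rw [interpolatedLimit, Finset.sum_eq_single r₀]
  · have hprod : ∏ j, fejerWeight N (p.2 (Sum.inr j) - ((r₀ j : ℕ) : ℝ) / N) = 1 := by
      refine Finset.prod_eq_one fun j _ => ?_
      have h1 : p.2 (Sum.inr j) - ((r₀ j : ℕ) : ℝ) / N = ((e j / N : ℤ) : ℝ) := by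
        have h2 := congrFun hshift j
        simp only [Function.comp_apply, intShift] at h2
        rw [h2]
        ring
      rw [h1, fejerWeight_intCast hN]
    rw [hprod, mul_one, hshift, limitFunction_add_int]
  · intro r _ hr
    obtain ⟨j, hj⟩ := Function.ne_iff.mp hr
    rw [Finset.prod_eq_zero (Finset.mem_univ j), mul_zero]
    have h1 : p.2 (Sum.inr j) - ((r j : ℕ) : ℝ) / N = ((e j - (r j : ℕ) : ℤ) : ℝ) / N := by
      rw [hval]
      push_cast
      ring
    rw [h1]
    refine fejerWeight_div_eq_zero hN fun hdvd => hj (Fin.ext ?_)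
    have h3 : ((r j : ℕ) : ℤ) % N = e j % N := Int.modEq_iff_dvd.mpr hdvd
    rw [← hr₀, Int.emod_eq_of_lt (by positivity) (by exact_mod_cast (r j).2)] at h3
    exact_mod_cast h3
  · exact fun h => absurd (Finset.mem_univ r₀) h

end NormalForm

end

/-! ### The main theorem -/

theorem proposition4p2 {g₁ g₂ : ℕ} (hg : 1 ≤ g₁ + g₂)
    (F : PPAVFamily (Fin g₁ ⊕ Fin g₂)) (P : F.PeriodMap) (D : NormalForm P.T) :
    (∃ α : (Fin g₁ ⊕ Fin g₂ → ℝ) × (Fin g₁ ⊕ Fin g₂ → ℝ) → ℝ,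
      AnalyticOnNhd ℝ α Set.univ ∧ (∀ p, 0 ≤ α p) ∧ α ≠ 0 ∧
      ∀ (z : (t : PuncturedDisc) → F.fiber t) (a b : Fin g₁ ⊕ Fin g₂ → ℝ),
        P.IsLift z (P.flatMap a b) →
        ∃ x : RealTorus D.B, D.IsTrop z x ∧
          Tendsto (D.scaledTheta (P.flatMap a b) x) toPuncture (𝓝 (α (a, b)))) ∧
    (∀ c : Fin g₂ → ℝ, ∃ α : (Fin g₁ ⊕ Fin g₂ → ℝ) × (Fin g₁ ⊕ Fin g₂ → ℝ) → ℝ,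
      AnalyticOnNhd ℝ α Set.univ ∧ (∀ p, 0 ≤ α p) ∧
      (∃ a b : Fin g₁ ⊕ Fin g₂ → ℝ, b ∘ Sum.inr = c ∧ α (a, b) ≠ 0) ∧
      ∀ a b : Fin g₁ ⊕ Fin g₂ → ℝ, b ∘ Sum.inr = c →
        ∃ x : RealTorus D.B, D.HasTrop (P.flatMap a b) x ∧
          Tendsto (D.scaledTheta (P.flatMap a b) x) toPuncture (𝓝 (α (a, b)))) := by
  have hsymm : ∀ w : ℂ, 0 < w.im → (P.T w).IsSymm := fun w hw => (P.mem_siegel w hw).1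
  constructor
  · obtain ⟨N, hN, hden⟩ := D.exists_denominator
    refine ⟨D.interpolatedLimit N, fun p _ => D.analyticAt_interpolatedLimit hsymm N p,
      D.interpolatedLimit_nonneg N, fun h0 => ?_, fun z a b hz => ?_⟩
    -- `c = 0` has every denominator, so there the interpolation agrees with a limit function known
    -- to be nonzero somewhere.
    · obtain ⟨a, b, hb, hne⟩ := D.exists_limitFunction_ne_zero 0
      refine hne ?_
      have h1 := D.interpolatedLimit_eq hN (a, b) fun j => ⟨0, by
        have := congrFun hb j
        simp only [Function.comp_apply, Pi.zero_apply] at this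
        simp [this]⟩
      rw [h0, hb] at h1
      exact h1.symm
    · refine ⟨QuotientAddGroup.mk (D.B *ᵥ (b ∘ Sum.inr)),
        ⟨P.flatMap a b, fun i => ?_, hz, D.hasTrop_add_mulVec a b⟩, ?_⟩
      · simp only [PPAVFamily.PeriodMap.flatMap, Pi.add_apply, mulVec, dotProduct]
        exact (differentiableOn_const _).add (DifferentiableOn.fun_sum fun j _ =>
          (P.holomorphic_T i j).mul_const _)
      · rw [D.interpolatedLimit_eq hN (a, b) (hden z a b hz)]
        exact D.tendsto_scaledTheta_limitFunction P.mem_siegel a b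
  · intro c
    refine ⟨D.limitFunction c, fun p _ => D.analyticAt_limitFunction hsymm c p,
      D.limitFunction_nonneg c, D.exists_limitFunction_ne_zero c, fun a b hb => ?_⟩
    subst hb
    exact ⟨_, D.hasTrop_add_mulVec a b, D.tendsto_scaledTheta_limitFunction P.mem_siegel a b⟩
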